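/- Let $\{X_n,\ n\ge 1\}$ be a sequence of i.i.d. real random variables with $E(X_1)=0$ and $E(X_1^2)=1$, and let $S_n=\sum_{i=1}^n X_i$. For $1\le i\le n$ let $M_n^{(i)}$ denote the $i$-th largest of $X_1,\dots,X_n$ (counted with multiplicity), so that $M_n^{(1)}=\max(X_1,\dots,X_n)$. Suppose that there are constants $a_n>0$, $b_n\in\mathbb R$, $n\ge1$, such that for every $x\in\mathbb R$ $$\lim_{n\to\infty}P\bigl(a_n(M_n^{(1)}-b_n)\le x\bigr)=G(x),$$ where $G$ is one of the following distribution functions: the Gumbel distribution $\Lambda(x)=\exp(-e^{-x})$; the Fréchet distribution $\Phi_\alpha(x)=0$ for $x\le 0$, $\Phi_\alpha(x)=\exp(-x^{-\alpha})$ for $x>0$, for some $\alpha>2$; or the Weibull distribution $\Psi_\alpha(x)=\exp(-(-x)^\alpha)$ for $x\le0$, $\Psi_\alpha(x)=1$ for $x>0$, for some $\alpha>0$. Let $k\ge1$ be fixed. Then the normalised $k$ largest order statistics have a joint limit law: there is a probability distribution function $H$ on $\mathbb R^k$ such that for all $x_1,\dots,x_k\in\mathbb R$ $$\lim_{n\to\infty}P\bigl(a_n(M_n^{(1)}-b_n)\le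 x_1,\dots,a_n(M_n^{(k)}-b_n)\le x_k\bigr)=H(x_1,\dots,x_k),$$ and for all $x_1,\dots,x_k,y\in\mathbb R$ $$\lim_{n\to\infty}P\Bigl(a_n(M_n^{(1)}-b_n)\le x_1,\dots,a_n(M_n^{(k)}-b_n)\le x_k,\ \frac{S_n}{\sqrt n}\le y\Bigr)=H(x_1,\dots,x_k)\,\Phi(y),$$ where $\Phi$ is the standard normal distribution function. Hence the $k$ largest order statistics are jointly asymptotically independent of the partial sum: for all $x_1,\dots,x_k,y\in\mathbb R$, the difference between the probability in the last display and $$P\bigl(a_n(M_n^{(1)}-b_n)\le x_1,\dots,a_n(M_n^{(k)}-b_n)\le x_k\bigr)\,P\Bigl(\frac{S_n}{\sqrt n}\le y\Bigr)$$ tends to $0$ as $n\to\infty$. -/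

import Mathlib

open MeasureTheory ProbabilityTheory Filter Topology

noncomputable section

/-- The `k`-th maximum `M_n^{(k)}` (`k = 1, 2, …, n`) of the first `n` terms
`x 0, …, x (n - 1)` of a real sequence: the `k`-th entry of the list of these `n` numbers, counted
with multiplicity and sorted in decreasing order. (For `k = 0` the value is that for `k = 1`, and
for `k > n` it is `0`; neither has a meaning.) -/
def kthMax (x : ℕ → ℝ) (n k : ℕ) : ℝ :=
  (((Multiset.range n).map x).sort (· ≥ ·)).getD (k - 1) 0

/-- The Gumbel distribution function `Λ`. -/
def gumbelCDF (x : ℝ) : ℝ := Real.exp (-Real.exp (-x))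

/-- The Fréchet distribution function `Φ_α`. -/
def frechetCDF (α x : ℝ) : ℝ := if x ≤ 0 then 0 else Real.exp (-x ^ (-α))

/-- The Weibull extreme value distribution function `Ψ_α`. -/
def weibullCDF (α x : ℝ) : ℝ := if x ≤ 0 then Real.exp (-(-x) ^ α) else 1

/-- `G` is `Λ`, or `Φ_α` for some `α > 2`, or `Ψ_α` for some `α > 0`. -/
def IsExtremeValueCDF (G : ℝ → ℝ) : Prop :=
  G = gumbelCDF ∨ (∃ α : ℝ, 2 < α ∧ G = frechetCDF α) ∨ (∃ α : ℝ, 0 < α ∧ G = weibullCDF α)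

/-- The event that the normalised `k` largest order statistics of `X 0, …, X (n - 1)` satisfy
`a_n (M_n^{(1)} - b_n) ≤ x_1, …, a_n (M_n^{(k)} - b_n) ≤ x_k`
(the coordinate `x i`, `i = 0, …, k - 1`, is `x_{i+1}`). -/
def topEvent {Ω : Type*} (X : ℕ → Ω → ℝ) (a b : ℕ → ℝ) (n k : ℕ) (x : Fin k → ℝ) : Set Ω :=
  {ω | ∀ i : Fin k, a n * (kthMax (fun j => X j ω) n (i + 1) - b n) ≤ x i}

/-- The event `S_n / √n ≤ y`, where `S_n = X 0 + … + X (n - 1)`. -/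
def sumEvent {Ω : Type*} (X : ℕ → Ω → ℝ) (n : ℕ) (y : ℝ) : Set Ω :=
  {ω | (∑ j ∈ Finset.range n, X j ω) / √(n : ℝ) ≤ y}

end

/-! For large `n` the condition on the `i`-th largest value says that at most `i - 1` of the
variables exceed the level `b n + x i / a n`. The indicator of such conditions on the counts `N l`
is recovered from the products `∏ z l ^ N l`, `|z l| = 1`, by integration over a torus against a
fixed trigonometric polynomial. These products, and `exp (i t S_n / √n)`, are products over the
sample, so by independence the expectations needed are torus integrals of `n`-th powers of
one-variable integrals (`setIntegral_countEvent`).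

Asymptotic independence then reduces to one variable: if `g` is the weight of the levels and `e x =
exp (i t x / √n)`, then `E[g e] - E[g] E[e] = o(1 / n)`
(`tendsto_mul_integral_levelWeight_mul_sub`). Indeed `g - 1` lives above the levels, a set of mass
`O(1 / n)`, and `|e - 1| ≤ |t x| / √n`; by Cauchy–Schwarz and the finite second moment, `E[|X|; X >
level] = o(1 / √n)`. Dominated convergence on the torus and the continuity theorem for
characteristic functions give the product limit.

This needs `n P(X > level)` to converge, which holds where `G > 0`. Where `G` vanishes at some
coordinate, a Markov bound makes the probability tend to `0` (`measureReal_exceedances_le`).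
Finally, tightness and right-continuity show that the limit function is the distribution function of
a probability measure `H`. -/

noncomputable section

/-! ### Order statistics, exceedance counts and multiplicative weights. -/

/-- The number of indices `j < n` with `x j > u`. -/
def exceedances (x : ℕ → ℝ) (n : ℕ) (u : ℝ) : ℕ := ((Finset.range n).filter (u < x ·)).card

/-- The event that, for each `i`, at most `i` of `X 0, …, X (n - 1)` exceed `u i`. -/
def countEvent {Ω : Type*} {k : ℕ} (X : ℕ → Ω → ℝ) (n : ℕ) (u : Fin k → ℝ) : Set Ω :=
  {ω | ∀ i : Fin k, exceedances (X · ω) n (u i) ≤ i}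

/-- The product of the weights `z l` of the levels `u l` lying below `x`. -/
def levelWeight {k : ℕ} (u : Fin k → ℝ) (z : Fin k → ℂ) (x : ℝ) : ℂ :=
  ∏ l, if u l < x then z l else 1

/-- In a decreasing list the entries above `u` form an initial segment, whose length is the count;
position `i` lies outside it exactly when that length is at most `i`. -/
lemma List.getElem_le_iff_countP_le {l : List ℝ} (hl : l.Pairwise (· ≥ ·)) {i : ℕ}
    (hi : i < l.length) (u : ℝ) : l[i] ≤ u ↔ l.countP (u < ·) ≤ i := by
  constructor
  · intro h
    rw [← List.take_append_drop i l, List.countP_append]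
    have h0 : (l.drop i).countP (u < ·) = 0 := by
      rw [List.countP_eq_zero]
      intro a ha
      obtain ⟨m, hm, rfl⟩ := List.mem_iff_getElem.1 ha
      rw [List.getElem_drop]
      rw [List.length_drop] at hm
      simp only [decide_eq_true_eq, not_lt]
      rcases Nat.eq_zero_or_pos m with rfl | hm0
      · simpa using h
      · exact le_trans (List.pairwise_iff_getElem.1 hl i (i + m) hi (by omega) (by omega)) h
    rw [h0, add_zero]
    exact List.countP_le_length.trans (by simp)
  · intro h
    by_contra! hlt
    have h1 : (l.take (i + 1)).countP (u < ·) = (l.take (i + 1)).length := by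
      rw [List.countP_eq_length]
      intro a ha
      obtain ⟨m, hm, rfl⟩ := List.mem_iff_getElem.1 ha
      rw [List.length_take] at hm
      rw [List.getElem_take]
      simp only [decide_eq_true_eq]
      rcases Nat.lt_or_ge m i with hmi | hmi
      · exact hlt.trans_le (List.pairwise_iff_getElem.1 hl m i (by omega) hi hmi)
      · obtain rfl : m = i := by omega
        exact hlt
    have h2 := (List.take_sublist (i + 1) l).countP_le (p := (u < ·))
    rw [h1, List.length_take] at h2
    omega

lemma kthMax_le_iff (x : ℕ → ℝ) {n i : ℕ} (hi : i < n) (u : ℝ) :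
    kthMax x n (i + 1) ≤ u ↔ exceedances x n u ≤ i := by
  set l := ((Multiset.range n).map x).sort (· ≥ ·) with hl
  have hlen : l.length = n := by simp [hl]
  have hcount : l.countP (u < ·) = exceedances x n u := by
    rw [← Multiset.coe_countP, hl, Multiset.sort_eq, Multiset.countP_map]
    rfl
  rw [← hcount, ← List.getElem_le_iff_countP_le (Multiset.pairwise_sort _ _)
    (by omega : i < l.length)]
  have : kthMax x n (i + 1) = l[i]'(by omega) := by
    simp only [kthMax, Nat.add_sub_cancel, ← hl]
    exact List.getD_eq_getElem _ _ _
  rw [this]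

/-- The condition `k ≤ n` keeps the default value of `kthMax` out of play. -/
lemma topEvent_eq_countEvent {Ω : Type*} (X : ℕ → Ω → ℝ) (a b : ℕ → ℝ) {n k : ℕ} (hkn : k ≤ n)
    (ha : 0 < a n) (x : Fin k → ℝ) :
    topEvent X a b n k x = countEvent X n (fun i ↦ b n + x i / a n) := by
  ext ω
  refine forall_congr' fun i ↦ ?_
  rw [← kthMax_le_iff _ (i.2.trans_le hkn), ← sub_le_iff_le_add', le_div_iff₀' ha]

lemma countEvent_subset {Ω : Type*} {k : ℕ} (X : ℕ → Ω → ℝ) (n : ℕ) (u : Fin k → ℝ) (i : Fin k) :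
    countEvent X n u ⊆ {ω | exceedances (X · ω) n (u i) ≤ i} :=
  fun _ hω ↦ hω i

lemma measurable_exceedances {Ω : Type*} [MeasurableSpace Ω] {X : ℕ → Ω → ℝ}
    (hX : ∀ j, Measurable (X j)) (n : ℕ) (u : ℝ) :
    Measurable fun ω ↦ exceedances (X · ω) n u := by
  simp only [exceedances, Finset.card_filter]
  exact Finset.measurable_fun_sum _ fun j _ ↦
    Measurable.ite (measurableSet_lt measurable_const (hX j)) measurable_const measurable_const

lemma measurableSet_countEvent {Ω : Type*} [MeasurableSpace Ω] {k : ℕ} {X : ℕ → Ω → ℝ}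
    (hX : ∀ j, Measurable (X j)) (n : ℕ) (u : Fin k → ℝ) : MeasurableSet (countEvent X n u) := by
  simp only [countEvent, Set.ofPred_forall]
  exact MeasurableSet.iInter fun i ↦ measurable_exceedances hX n (u i) measurableSet_Iic

lemma pow_exceedances {M : Type*} [CommMonoid M] (x : ℕ → ℝ) (n : ℕ) (u : ℝ) (z : M) :
    z ^ exceedances x n u = ∏ j ∈ Finset.range n, if u < x j then z else 1 := by
  rw [exceedances, Finset.prod_ite]
  simp

/-- This turns a monomial in all the counts into a product over the sample, to which independence
applies. -/
lemma prod_levelWeight {k : ℕ} (x : ℕ → ℝ) (n : ℕ) (u : Fin k → ℝ) (z : Fin k → ℂ) :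
    ∏ j ∈ Finset.range n, levelWeight u z (x j) = ∏ l, z l ^ exceedances x n (u l) := by
  simp only [levelWeight, pow_exceedances]
  exact Finset.prod_comm

lemma norm_levelWeight {k : ℕ} (u : Fin k → ℝ) {z : Fin k → ℂ} (hz : ∀ l, ‖z l‖ = 1) (x : ℝ) :
    ‖levelWeight u z x‖ = 1 := by
  rw [levelWeight, norm_prod]
  refine Finset.prod_eq_one fun l _ ↦ ?_
  split_ifs <;> simp [hz]

lemma norm_levelWeight_sub_one_le {k : ℕ} (u : Fin k → ℝ) {z : Fin k → ℂ} (hz : ∀ l, ‖z l‖ = 1)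
    (x : ℝ) : ‖levelWeight u z x - 1‖ ≤ 2 * ∑ l, (Set.Ioi (u l)).indicator 1 x := by
  by_cases h : ∃ l, u l < x
  · obtain ⟨l, hl⟩ := h
    have h1 : (1 : ℝ) ≤ ∑ l, (Set.Ioi (u l)).indicator 1 x := by
      refine le_trans ?_ (Finset.single_le_sum (f := fun l ↦ (Set.Ioi (u l)).indicator (1 : ℝ → ℝ) x)
        (fun i _ ↦ Set.indicator_nonneg (by simp) _) (Finset.mem_univ l))
      simp [hl]
    calc ‖levelWeight u z x - 1‖ ≤ ‖levelWeight u z x‖ + ‖(1 : ℂ)‖ := norm_sub_le _ _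
      _ ≤ 2 * ∑ l, (Set.Ioi (u l)).indicator 1 x := by rw [norm_levelWeight u hz, norm_one]; linarith
  · push Not at h
    have : levelWeight u z x = 1 := Finset.prod_eq_one fun l _ ↦ if_neg (h l).not_gt
    rw [this, sub_self, norm_zero]
    exact mul_nonneg zero_le_two (Finset.sum_nonneg fun i _ ↦ Set.indicator_nonneg (by simp) _)

lemma measurable_levelWeight {k : ℕ} (u : Fin k → ℝ) (z : Fin k → ℂ) :
    Measurable (levelWeight u z) :=
  Finset.measurable_fun_prod _ fun _ _ ↦
    Measurable.ite (measurableSet_lt measurable_const measurable_id) measurable_const measurable_const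

/-! ### Expectations of products over an i.i.d. sample. -/

section IID

variable {Ω : Type*} [MeasurableSpace Ω] {P : Measure Ω} {X : ℕ → Ω → ℝ}

lemma integral_prod_range_comp {𝕜 : Type*} [RCLike 𝕜] (hX : ∀ j, Measurable (X j))
    (hindep : iIndepFun X P) (hident : ∀ j, IdentDistrib (X j) (X 0) P P) {f : ℝ → 𝕜}
    (hf : Measurable f) (n : ℕ) :
    ∫ ω, ∏ j ∈ Finset.range n, f (X j ω) ∂P = (∫ x, f x ∂(P.map (X 0))) ^ n := by
  simp_rw [Finset.prod_range]
  rw [(hindep.precomp Fin.val_injective).integral_fun_prod_comp (f := fun _ : Fin n ↦ f)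
    (fun j ↦ (hX j).aemeasurable) (fun _ ↦ hf.aestronglyMeasurable)]
  have (i : ℕ) : ∫ ω, f (X i ω) ∂P = ∫ x, f x ∂(P.map (X 0)) := by
    rw [← (hident i).map_eq, integral_map (hX i).aemeasurable hf.aestronglyMeasurable]
  simp [this]

lemma integral_pow_exceedances [IsProbabilityMeasure P] (hX : ∀ j, Measurable (X j))
    (hindep : iIndepFun X P) (hident : ∀ j, IdentDistrib (X j) (X 0) P P) (n : ℕ) (u z : ℝ) :
    ∫ ω, z ^ exceedances (X · ω) n u ∂P = (1 - (1 - z) * (P.map (X 0)).real (Set.Ioi u)) ^ n := by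
  have := Measure.isProbabilityMeasure_map (hX 0).aemeasurable (μ := P)
  simp_rw [pow_exceedances]
  rw [integral_prod_range_comp hX hindep hident (f := fun x ↦ if u < x then z else 1)
    (Measurable.ite measurableSet_Ioi measurable_const measurable_const)]
  congr 1
  have : (fun x ↦ if u < x then z else 1) =
      fun x ↦ 1 - (1 - z) * (Set.Ioi u).indicator (fun _ ↦ (1 : ℝ)) x := by
    ext x
    by_cases h : u < x <;> simp [h]
  rw [this, integral_sub (integrable_const _)
    (((integrable_const _).indicator measurableSet_Ioi).const_mul _), integral_const_mul,
    integral_indicator_const _ measurableSet_Ioi]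
  simp

end IID

/-! ### Fourier inversion for the counts on the torus. -/

/-- The trigonometric polynomial on the `k`-torus whose product with `∏ l, e^{2πi N l s l}`,
`N l ≥ 0`, has integral `1` if `N l ≤ l` for all `l`, and `0` otherwise. -/
def torusKernel (k : ℕ) (s : Fin k → UnitAddCircle) : ℂ :=
  ∏ l : Fin k, ∑ m ∈ Finset.range (l + 1), fourier (-(m : ℤ)) (s l)

/-- The Haar probability measure on the `k`-torus. -/
abbrev torusMeasure (k : ℕ) : Measure (Fin k → UnitAddCircle) :=
  Measure.pi fun _ ↦ AddCircle.haarAddCircle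

lemma continuous_torusKernel (k : ℕ) : Continuous (torusKernel k) := by
  unfold torusKernel
  fun_prop

lemma exists_norm_torusKernel_le (k : ℕ) : ∃ C, ∀ s, ‖torusKernel k s‖ ≤ C := by
  obtain ⟨C, hC⟩ := isCompact_univ.exists_bound_of_continuousOn
    (continuous_torusKernel k).continuousOn
  exact ⟨C, fun s ↦ hC s (Set.mem_univ s)⟩

lemma norm_fourier_apply {n : ℤ} (s : UnitAddCircle) : ‖fourier n s‖ = 1 := by
  rw [fourier_apply, Circle.norm_coe]

lemma integral_fourier (n : ℤ) :
    ∫ s : UnitAddCircle, fourier n s ∂AddCircle.haarAddCircle = if n = 0 then 1 else 0 := by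
  have h := fourierCoeff_fourier (T := 1) n
  have h0 := congrFun h 0
  simp only [fourierCoeff, neg_zero, fourier_zero, one_smul] at h0
  rw [h0, Pi.single_apply]
  simp [eq_comm]

/-- Orthogonality of characters: the term `m` contributes `1` exactly when `m = N`. -/
lemma integral_sum_fourier_mul_pow (l N : ℕ) :
    ∫ s : UnitAddCircle, (∑ m ∈ Finset.range (l + 1), fourier (-(m : ℤ)) s) * fourier 1 s ^ N
      ∂AddCircle.haarAddCircle = if N ≤ l then 1 else 0 := by
  have hpow (s : UnitAddCircle) (m : ℕ) :
      fourier (-(m : ℤ)) s * fourier 1 s ^ N = fourier ((N : ℤ) - m) s := by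
    have : fourier 1 s ^ N = fourier (N : ℤ) s := by
      induction N with
      | zero => simp
      | succ N ih => rw [pow_succ, ih, ← fourier_add]; simp
    rw [this, ← fourier_add]
    congr 2
    ring
  simp_rw [Finset.sum_mul, hpow]
  rw [integral_finsetSum _ fun m _ ↦ (map_continuous _).integrable_of_hasCompactSupport
    (HasCompactSupport.of_compactSpace _)]
  simp_rw [integral_fourier]
  have (m : ℕ) : ((N : ℤ) - m = 0) ↔ N = m := by omega
  simp [this]

lemma integral_torusKernel_mul_prod_pow {k : ℕ} (N : Fin k → ℕ) :
    ∫ s, torusKernel k s * ∏ l, fourier 1 (s l) ^ N l ∂torusMeasure k =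
      if ∀ l, N l ≤ l then 1 else 0 := by
  simp_rw [torusKernel, ← Finset.prod_mul_distrib]
  rw [integral_fintype_prod_eq_prod (𝕜 := ℂ)
    (fun (l : Fin k) (s : UnitAddCircle) ↦
      (∑ m ∈ Finset.range (l + 1), fourier (-(m : ℤ)) s) * fourier 1 s ^ N l)]
  simp_rw [integral_sum_fourier_mul_pow]
  rw [Finset.prod_ite_zero]
  simp

lemma measurable_levelWeight_fourier {k : ℕ} (u : Fin k → ℝ) :
    Measurable fun p : (Fin k → UnitAddCircle) × ℝ ↦
      levelWeight u (fun l ↦ fourier 1 (p.1 l)) p.2 := by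
  refine Finset.measurable_fun_prod _ fun l _ ↦ Measurable.ite
    (measurableSet_lt measurable_const measurable_snd) ?_ measurable_const
  exact (by fun_prop : Continuous fun p : (Fin k → UnitAddCircle) × ℝ ↦
    (fourier 1 (p.1 l) : ℂ)).measurable

section IID

variable {Ω : Type*} [MeasurableSpace Ω] {P : Measure Ω} [IsProbabilityMeasure P] {X : ℕ → Ω → ℝ}

/-- Write the indicator of the event as a torus integral, exchange the integrals, and factor the
expectation by independence. The free factor `e` covers both the probability (`e = 1`) and the
characteristic function of the sum. -/
lemma setIntegral_countEvent {k : ℕ} (hX : ∀ j, Measurable (X j))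
    (hindep : iIndepFun X P) (hident : ∀ j, IdentDistrib (X j) (X 0) P P) {e : ℝ → ℂ}
    (he : Measurable e) (he1 : ∀ x, ‖e x‖ = 1) (n : ℕ) (u : Fin k → ℝ) :
    ∫ ω in countEvent X n u, ∏ j ∈ Finset.range n, e (X j ω) ∂P =
      ∫ s, torusKernel k s *
        (∫ x, levelWeight u (fun l ↦ fourier 1 (s l)) x * e x ∂(P.map (X 0))) ^ n
        ∂torusMeasure k := by
  obtain ⟨C, hC⟩ := exists_norm_torusKernel_le k
  rw [← integral_indicator (measurableSet_countEvent hX n u)]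
  have hind (ω : Ω) : (countEvent X n u).indicator
      (fun ω ↦ ∏ j ∈ Finset.range n, e (X j ω)) ω =
      ∫ s, torusKernel k s * ∏ j ∈ Finset.range n,
        (levelWeight u (fun l ↦ fourier 1 (s l)) (X j ω) * e (X j ω)) ∂torusMeasure k := by
    simp_rw [Finset.prod_mul_distrib, prod_levelWeight, ← mul_assoc]
    rw [integral_mul_const, integral_torusKernel_mul_prod_pow]
    by_cases h : ω ∈ countEvent X n u
    · rw [Set.indicator_of_mem h, if_pos (by exact h), one_mul]
    · rw [Set.indicator_of_notMem h, if_neg (by exact h), zero_mul]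
  simp_rw [hind]
  rw [integral_integral_swap]
  · refine integral_congr_ae (ae_of_all _ fun s ↦ ?_)
    simp only
    rw [integral_const_mul]
    congr 1
    exact integral_prod_range_comp hX hindep hident (f := fun x ↦
      levelWeight u (fun l ↦ fourier 1 (s l)) x * e x) ((measurable_levelWeight _ _).mul he) n
  · refine Integrable.of_bound (C := C) ?_ (ae_of_all _ fun p ↦ ?_)
    · refine Measurable.aestronglyMeasurable ?_
      refine ((continuous_torusKernel k).measurable.comp measurable_snd).mul
        (Finset.measurable_fun_prod _ fun j _ ↦ ?_)
      have h1 : Measurable fun p : Ω × (Fin k → UnitAddCircle) ↦ (p.2, X j p.1) :=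
        measurable_snd.prodMk ((hX j).comp measurable_fst)
      exact ((measurable_levelWeight_fourier u).comp h1).mul
        (he.comp ((hX j).comp measurable_fst))
    · simp only [Function.uncurry, norm_mul, norm_prod]
      rw [Finset.prod_eq_one, mul_one]
      · exact hC _
      · intro j _
        rw [norm_levelWeight _ fun l ↦ norm_fourier_apply _, he1, one_mul]

lemma measureReal_countEvent {k : ℕ} (hX : ∀ j, Measurable (X j))
    (hindep : iIndepFun X P) (hident : ∀ j, IdentDistrib (X j) (X 0) P P) (n : ℕ)
    (u : Fin k → ℝ) :
    (P.real (countEvent X n u) : ℂ) =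
      ∫ s, torusKernel k s *
        (∫ x, levelWeight u (fun l ↦ fourier 1 (s l)) x ∂(P.map (X 0))) ^ n
        ∂torusMeasure k := by
  have := setIntegral_countEvent hX hindep hident (e := fun _ ↦ 1) measurable_const
    (fun _ ↦ norm_one) n u
  simpa using this

end IID

lemma measurable_integral_levelWeight {k : ℕ} (u : Fin k → ℝ) {e : ℝ → ℂ} (he : Measurable e)
    (μ : Measure ℝ) [SFinite μ] :
    Measurable fun s : Fin k → UnitAddCircle ↦
      ∫ x, levelWeight u (fun l ↦ fourier 1 (s l)) x * e x ∂μ := by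
  have : StronglyMeasurable fun p : (Fin k → UnitAddCircle) × ℝ ↦
      levelWeight u (fun l ↦ fourier 1 (p.1 l)) p.2 * e p.2 :=
    ((measurable_levelWeight_fourier u).mul (he.comp measurable_snd)).stronglyMeasurable
  exact this.integral_prod_right.measurable

/-- Dominated convergence on the torus. -/
lemma tendsto_integral_torusKernel_mul {k : ℕ} {F : ℕ → (Fin k → UnitAddCircle) → ℂ}
    {f : (Fin k → UnitAddCircle) → ℂ} {C : ℝ} (hF : ∀ n, Measurable (F n))
    (hC : ∀ n s, ‖F n s‖ ≤ C) (h : ∀ s, Tendsto (F · s) atTop (𝓝 (f s))) :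
    Tendsto (fun n ↦ ∫ s, torusKernel k s * F n s ∂torusMeasure k) atTop
      (𝓝 (∫ s, torusKernel k s * f s ∂torusMeasure k)) := by
  obtain ⟨D, hD⟩ := exists_norm_torusKernel_le k
  refine tendsto_integral_of_dominated_convergence (fun _ ↦ D * C)
    (fun n ↦ ((continuous_torusKernel k).measurable.mul (hF n)).aestronglyMeasurable)
    (integrable_const _) (fun n ↦ ae_of_all _ fun s ↦ ?_)
    (ae_of_all _ fun s ↦ (h s).const_mul _)
  rw [norm_mul]
  exact mul_le_mul (hD s) (hC n s) (norm_nonneg _) ((norm_nonneg _).trans (hD s))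

/-! ### One-variable asymptotics above high levels. -/

section Levels

variable {μ : Measure ℝ} {k : ℕ} {u : ℕ → Fin k → ℝ} {τ : Fin k → ℝ}

/-- The scaled mass above finitely many levels converges. -/
lemma exists_tendsto_mul_measureReal_iInter_Ioi
    (hmono : ∀ l m, (∀ᶠ n in atTop, u n l ≤ u n m) ∨ (∀ᶠ n in atTop, u n m ≤ u n l))
    (hτ : ∀ l, Tendsto (fun n : ℕ ↦ n * μ.real (Set.Ioi (u n l))) atTop (𝓝 (τ l)))
    {T : Finset (Fin k)} (hT : T.Nonempty) :
    ∃ c, Tendsto (fun n : ℕ ↦ n * μ.real (⋂ l ∈ T, Set.Ioi (u n l))) atTop (𝓝 c) := by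
  -- The levels in `T` are pairwise eventually ordered, so the intersection is eventually the
  -- half-line above one fixed, largest level.
  obtain ⟨m, hm, hmax⟩ : ∃ m ∈ T, ∀ l ∈ T, ∀ᶠ n in atTop, u n l ≤ u n m := by
    induction hT using Finset.Nonempty.cons_induction with
    | singleton a => exact ⟨a, by simp, by simp⟩
    | cons a s ha hs ih =>
      obtain ⟨m, hm, hmax⟩ := ih
      rcases hmono a m with h | h
      · refine ⟨m, Finset.mem_cons_of_mem hm, fun l hl ↦ ?_⟩
        rcases Finset.mem_cons.1 hl with rfl | hl
        exacts [h, hmax l hl]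
      · refine ⟨a, Finset.mem_cons_self _ _, fun l hl ↦ ?_⟩
        rcases Finset.mem_cons.1 hl with rfl | hl
        · exact Eventually.of_forall fun _ ↦ le_rfl
        · filter_upwards [hmax l hl, h] with n h1 h2 using h1.trans h2
  refine ⟨τ m, (hτ m).congr' ?_⟩
  filter_upwards [(eventually_all_finset T).2 hmax] with n hn
  congr 2
  refine subset_antisymm (fun x hx ↦ Set.mem_iInter₂.2 fun l hl ↦ (hn l hl).trans_lt hx)
    fun x hx ↦ Set.mem_iInter₂.1 hx m hm

variable [IsProbabilityMeasure μ]

lemma integrable_levelWeight_mul (v : Fin k → ℝ) {z : Fin k → ℂ} (hz : ∀ l, ‖z l‖ = 1)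
    {e : ℝ → ℂ} (he : Measurable e) (he1 : ∀ x, ‖e x‖ = 1) :
    Integrable (fun x ↦ levelWeight v z x * e x) μ :=
  Integrable.of_bound (C := 1) ((measurable_levelWeight v z).mul he).aestronglyMeasurable
    (ae_of_all _ fun x ↦ by rw [norm_mul, norm_levelWeight v hz, he1, one_mul])

lemma integrable_levelWeight (v : Fin k → ℝ) {z : Fin k → ℂ} (hz : ∀ l, ‖z l‖ = 1) :
    Integrable (levelWeight v z) μ := by
  simpa using integrable_levelWeight_mul (μ := μ) v hz (e := fun _ ↦ 1) measurable_const
    (fun _ ↦ norm_one)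

lemma norm_integral_levelWeight_mul_le (v : Fin k → ℝ) {z : Fin k → ℂ} (hz : ∀ l, ‖z l‖ = 1)
    {e : ℝ → ℂ} (he1 : ∀ x, ‖e x‖ = 1) : ‖∫ x, levelWeight v z x * e x ∂μ‖ ≤ 1 := by
  refine (norm_integral_le_of_norm_le_const (C := 1) (ae_of_all _ fun x ↦ ?_)).trans (by simp)
  rw [norm_mul, norm_levelWeight v hz, he1, one_mul]

lemma norm_integral_levelWeight_le (v : Fin k → ℝ) {z : Fin k → ℂ} (hz : ∀ l, ‖z l‖ = 1) :
    ‖∫ x, levelWeight v z x ∂μ‖ ≤ 1 := by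
  simpa using norm_integral_levelWeight_mul_le (μ := μ) v hz (e := fun _ ↦ 1) (fun _ ↦ norm_one)

/-- Expansion of `∏ l, (1 + (z l - 1) 1_{u l < x})` over subsets; the empty subset gives the
constant `1`, removed in the next lemma. -/
lemma levelWeight_eq_sum (v : Fin k → ℝ) (z : Fin k → ℂ) (x : ℝ) :
    levelWeight v z x = ∑ T : Finset (Fin k),
      (⋂ l ∈ T, Set.Ioi (v l)).indicator (fun _ ↦ ∏ l ∈ T, (z l - 1)) x := by
  have h (l : Fin k) : (if v l < x then z l else 1) = (if v l < x then z l - 1 else 0) + 1 := by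
    split_ifs <;> simp
  simp_rw [levelWeight, h]
  rw [Finset.prod_add_one, Finset.powerset_univ]
  refine Finset.sum_congr rfl fun T _ ↦ ?_
  classical
  rw [Finset.prod_ite_zero, Set.indicator_apply]
  simp

lemma exists_tendsto_mul_integral_levelWeight_sub_one
    (hmono : ∀ l m, (∀ᶠ n in atTop, u n l ≤ u n m) ∨ (∀ᶠ n in atTop, u n m ≤ u n l))
    (hτ : ∀ l, Tendsto (fun n : ℕ ↦ n * μ.real (Set.Ioi (u n l))) atTop (𝓝 (τ l)))
    (z : Fin k → ℂ) :
    ∃ c, Tendsto (fun n : ℕ ↦ (n : ℂ) * (∫ x, levelWeight (u n) z x ∂μ - 1)) atTop (𝓝 c) := by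
  have hint (v : Fin k → ℝ) : ∫ x, levelWeight v z x ∂μ - 1 =
      ∑ T ∈ Finset.univ.erase (∅ : Finset (Fin k)),
        (μ.real (⋂ l ∈ T, Set.Ioi (v l)) : ℂ) * ∏ l ∈ T, (z l - 1) := by
    have hms (T : Finset (Fin k)) : MeasurableSet (⋂ l ∈ T, Set.Ioi (v l)) :=
      T.measurableSet_biInter fun l _ ↦ measurableSet_Ioi
    simp_rw [levelWeight_eq_sum]
    rw [integral_finsetSum _ fun T _ ↦ (integrable_const _).indicator (hms T)]
    simp_rw [integral_indicator_const _ (hms _), Complex.real_smul]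
    rw [← Finset.add_sum_erase _ _ (Finset.mem_univ ∅)]
    simp
  have hT (T : Finset (Fin k)) : ∃ c, T ∈ Finset.univ.erase (∅ : Finset (Fin k)) →
      Tendsto (fun n : ℕ ↦ (n : ℝ) * μ.real (⋂ l ∈ T, Set.Ioi (u n l))) atTop (𝓝 c) := by
    by_cases h : T = ∅
    · exact ⟨0, fun h' ↦ absurd h (Finset.ne_of_mem_erase h')⟩
    · obtain ⟨c, hc⟩ := exists_tendsto_mul_measureReal_iInter_Ioi hmono hτ
        (Finset.nonempty_iff_ne_empty.2 h)
      exact ⟨c, fun _ ↦ hc⟩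
  choose c hc using hT
  refine ⟨∑ T ∈ Finset.univ.erase (∅ : Finset (Fin k)), (c T : ℂ) * ∏ l ∈ T, (z l - 1), ?_⟩
  simp_rw [hint, Finset.mul_sum, ← mul_assoc]
  refine tendsto_finsetSum _ fun T hT ↦ Tendsto.mul_const _ ?_
  have := (Complex.continuous_ofReal.tendsto _).comp (hc T hT)
  simpa [Function.comp_def] using this

/-- For a law with finite second moment, the first absolute moment above levels with
`n μ(v n, ∞)` convergent is `o(1 / √n)`. -/
lemma tendsto_sqrt_mul_setIntegral_Ioi {v : ℕ → ℝ} {t : ℝ} (h2 : MemLp id 2 μ)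
    (ht : Tendsto (fun n : ℕ ↦ n * μ.real (Set.Ioi (v n))) atTop (𝓝 t)) :
    Tendsto (fun n : ℕ ↦ √n * ∫ x in Set.Ioi (v n), |x| ∂μ) atTop (𝓝 0) := by
  have hsq : Integrable (fun x : ℝ ↦ x ^ 2) μ := h2.integrable_sq
  have hp : Tendsto (fun n : ℕ ↦ μ.real (Set.Ioi (v n))) atTop (𝓝 0) := by
    have := ht.mul (tendsto_inv_atTop_nhds_zero_nat (𝕜 := ℝ))
    rw [mul_zero] at this
    refine this.congr' ?_
    filter_upwards [eventually_gt_atTop 0] with n hn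
    have : (n : ℝ) ≠ 0 := by positivity
    field_simp
  have hA : Tendsto (fun n : ℕ ↦ ∫ x in Set.Ioi (v n), x ^ 2 ∂μ) atTop (𝓝 0) := by
    -- Absolute continuity of the integral of `x ^ 2`: the masses of the half-lines tend to `0`.
    refine hsq.tendsto_setIntegral_nhds_zero ?_
    refine (ENNReal.tendsto_toReal_iff (fun n ↦ measure_ne_top _ _) ENNReal.zero_ne_top).1 ?_
    simpa [Measure.real] using hp
  have hlim : Tendsto (fun n : ℕ ↦ √(n * μ.real (Set.Ioi (v n))) *
      √(∫ x in Set.Ioi (v n), x ^ 2 ∂μ)) atTop (𝓝 0) := by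
    have := ht.sqrt.mul hA.sqrt
    simpa using this
  refine squeeze_zero (fun n ↦ mul_nonneg (Real.sqrt_nonneg _)
    (integral_nonneg fun _ ↦ abs_nonneg _)) (fun n ↦ ?_) hlim
  -- Cauchy–Schwarz against the constant function `1`.
  have hCS : ∫ x in Set.Ioi (v n), |x| ∂μ ≤
      √(μ.real (Set.Ioi (v n))) * √(∫ x in Set.Ioi (v n), x ^ 2 ∂μ) := by
    have h := integral_mul_le_Lp_mul_Lq_of_nonneg (μ := μ.restrict (Set.Ioi (v n)))
      Real.HolderConjugate.two_two (f := fun _ ↦ (1 : ℝ)) (g := fun x ↦ |x|)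
      (ae_of_all _ fun _ ↦ zero_le_one) (ae_of_all _ fun _ ↦ abs_nonneg _)
      (memLp_const 1) (by rw [ENNReal.ofReal_ofNat]; exact (h2.restrict _).abs)
    simpa [Real.sqrt_eq_rpow] using h
  calc √n * ∫ x in Set.Ioi (v n), |x| ∂μ
      ≤ √n * (√(μ.real (Set.Ioi (v n))) * √(∫ x in Set.Ioi (v n), x ^ 2 ∂μ)) := by gcongr
    _ = _ := by rw [Real.sqrt_mul (Nat.cast_nonneg n), mul_assoc]

/-- `x ↦ e^{itx/√n}`. -/
def scaledExp (t : ℝ) (n : ℕ) (x : ℝ) : ℂ := Complex.exp (((√n)⁻¹ * t * x : ℝ) * Complex.I)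

lemma measurable_scaledExp (t : ℝ) (n : ℕ) : Measurable (scaledExp t n) := by
  unfold scaledExp
  fun_prop

lemma norm_scaledExp (t : ℝ) (n : ℕ) (x : ℝ) : ‖scaledExp t n x‖ = 1 :=
  Complex.norm_exp_ofReal_mul_I _

lemma norm_scaledExp_sub_one_le (t : ℝ) (n : ℕ) (x : ℝ) :
    ‖scaledExp t n x - 1‖ ≤ (√n)⁻¹ * |t| * |x| := by
  have h := Real.norm_exp_I_mul_ofReal_sub_one_le (x := (√n)⁻¹ * t * x)
  rw [mul_comm] at h
  refine h.trans ?_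
  rw [Real.norm_eq_abs, abs_mul, abs_mul, abs_of_nonneg (inv_nonneg.2 (Real.sqrt_nonneg _))]

lemma integrable_scaledExp (t : ℝ) (n : ℕ) : Integrable (scaledExp t n) μ :=
  Integrable.of_bound (C := 1) (measurable_scaledExp t n).aestronglyMeasurable
    (ae_of_all _ fun x ↦ (norm_scaledExp t n x).le)

lemma tendsto_mul_integral_levelWeight_mul_sub (h2 : MemLp id 2 μ)
    (hτ : ∀ l, Tendsto (fun n : ℕ ↦ n * μ.real (Set.Ioi (u n l))) atTop (𝓝 (τ l)))
    {z : Fin k → ℂ} (hz : ∀ l, ‖z l‖ = 1) (t : ℝ) :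
    Tendsto (fun n : ℕ ↦ n * ‖∫ x, levelWeight (u n) z x * scaledExp t n x ∂μ -
      (∫ x, levelWeight (u n) z x ∂μ) * ∫ x, scaledExp t n x ∂μ‖) atTop (𝓝 0) := by
  have habs : Integrable (fun x : ℝ ↦ |x|) μ := (h2.integrable one_le_two).abs
  have hind (v : ℝ) : Integrable ((Set.Ioi v).indicator (1 : ℝ → ℝ)) μ :=
    (integrable_const (1 : ℝ)).indicator measurableSet_Ioi
  have hbound : Tendsto (fun n : ℕ ↦
      2 * |t| * ∑ l, √n * ∫ x in Set.Ioi (u n l), |x| ∂μ +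
      (2 * ∑ l, n * μ.real (Set.Ioi (u n l))) * ((√n)⁻¹ * |t| * ∫ x, |x| ∂μ))
      atTop (𝓝 0) := by
    have h1 : Tendsto (fun n : ℕ ↦ ∑ l, √n * ∫ x in Set.Ioi (u n l), |x| ∂μ) atTop (𝓝 0) := by
      simpa using tendsto_finsetSum Finset.univ
        fun l _ ↦ tendsto_sqrt_mul_setIntegral_Ioi h2 (hτ l)
    have h3 := tendsto_finsetSum Finset.univ fun l (_ : l ∈ Finset.univ) ↦ hτ l
    have h4 : Tendsto (fun n : ℕ ↦ (√(n : ℝ))⁻¹) atTop (𝓝 0) :=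
      tendsto_inv_atTop_zero.comp (Real.tendsto_sqrt_atTop.comp tendsto_natCast_atTop_atTop)
    have := (h1.const_mul (2 * |t|)).add
      ((h3.const_mul 2).mul ((h4.mul_const |t|).mul_const (∫ x, |x| ∂μ)))
    simpa using this
  refine squeeze_zero (fun n ↦ by positivity) (fun n ↦ ?_) hbound
  set g := levelWeight (u n) z
  set e := scaledExp t n
  have hg : Integrable g μ := integrable_levelWeight _ hz
  have he : Integrable e μ := integrable_scaledExp t n
  have hge : Integrable (fun x ↦ g x * e x) μ :=
    integrable_levelWeight_mul _ hz (measurable_scaledExp t n) (norm_scaledExp t n)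
  -- A covariance does not change when constants are subtracted; after subtracting `1` both factors
  -- are small.
  have hcov : ∫ x, g x * e x ∂μ - (∫ x, g x ∂μ) * ∫ x, e x ∂μ =
      ∫ x, (g x - 1) * (e x - 1) ∂μ - (∫ x, (g x - 1) ∂μ) * ∫ x, (e x - 1) ∂μ := by
    have : ∀ x, (g x - 1) * (e x - 1) = g x * e x - g x - e x + 1 := fun x ↦ by ring
    simp_rw [this]
    rw [integral_add (by exact (hge.sub hg).sub he) (integrable_const _),
      integral_sub (by exact hge.sub hg) he, integral_sub hge hg, integral_sub hg (integrable_const _),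
      integral_sub he (integrable_const _)]
    simp
    ring
  have hb1 : ‖∫ x, (g x - 1) * (e x - 1) ∂μ‖ ≤
      2 * ((√n)⁻¹ * |t|) * ∑ l, ∫ x in Set.Ioi (u n l), |x| ∂μ := by
    simp_rw [← integral_indicator (measurableSet_Ioi (a := u n _))]
    rw [← integral_finsetSum _ fun l _ ↦ habs.indicator measurableSet_Ioi, ← integral_const_mul]
    refine norm_integral_le_of_norm_le
      ((integrable_finsetSum _ fun l _ ↦ habs.indicator measurableSet_Ioi).const_mul _)
      (ae_of_all _ fun x ↦ ?_)
    rw [norm_mul]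
    refine (mul_le_mul (norm_levelWeight_sub_one_le _ hz x) (norm_scaledExp_sub_one_le t n x)
      (norm_nonneg _) ((norm_nonneg _).trans (norm_levelWeight_sub_one_le _ hz x))).trans_eq ?_
    have : ∀ l, (Set.Ioi (u n l)).indicator (fun x ↦ |x|) x =
        (Set.Ioi (u n l)).indicator 1 x * |x| := fun l ↦ by
      by_cases h : x ∈ Set.Ioi (u n l) <;> simp [h]
    simp_rw [this, ← Finset.sum_mul]
    ring
  have hb2 : ‖∫ x, (g x - 1) ∂μ‖ ≤ 2 * ∑ l, μ.real (Set.Ioi (u n l)) := by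
    have : ∀ l, μ.real (Set.Ioi (u n l)) = ∫ x, (Set.Ioi (u n l)).indicator 1 x ∂μ :=
      fun l ↦ (integral_indicator_one measurableSet_Ioi).symm
    simp_rw [this]
    rw [← integral_finsetSum _ fun l _ ↦ hind _, ← integral_const_mul]
    exact norm_integral_le_of_norm_le ((integrable_finsetSum _ fun l _ ↦ hind _).const_mul _)
      (ae_of_all _ fun x ↦ norm_levelWeight_sub_one_le _ hz x)
  have hb3 : ‖∫ x, (e x - 1) ∂μ‖ ≤ (√n)⁻¹ * |t| * ∫ x, |x| ∂μ := by
    rw [← integral_const_mul]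
    exact norm_integral_le_of_norm_le (habs.const_mul _)
      (ae_of_all _ fun x ↦ norm_scaledExp_sub_one_le t n x)
  have hsq : (n : ℝ) * (√n)⁻¹ = √n := by
    rw [← div_eq_mul_inv, Real.div_sqrt]
  rw [hcov]
  calc n * ‖∫ x, (g x - 1) * (e x - 1) ∂μ - (∫ x, (g x - 1) ∂μ) * ∫ x, (e x - 1) ∂μ‖
      ≤ n * (2 * ((√n)⁻¹ * |t|) * ∑ l, ∫ x in Set.Ioi (u n l), |x| ∂μ +
        (2 * ∑ l, μ.real (Set.Ioi (u n l))) * ((√n)⁻¹ * |t| * ∫ x, |x| ∂μ)) := by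
        refine mul_le_mul_of_nonneg_left ((norm_sub_le _ _).trans (add_le_add hb1 ?_))
          (Nat.cast_nonneg n)
        rw [norm_mul]
        exact mul_le_mul hb2 hb3 (norm_nonneg _) (by positivity)
    _ = _ := by
        rw [← Finset.mul_sum, ← Finset.mul_sum]
        linear_combination (2 * |t| * ∑ l, ∫ x in Set.Ioi (u n l), |x| ∂μ) * hsq

end Levels

/-! ### From one variable to the sample: limits of torus integrals. -/

lemma norm_pow_sub_pow_le_mul {a b : ℂ} (ha : ‖a‖ ≤ 1) (hb : ‖b‖ ≤ 1) (n : ℕ) :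
    ‖a ^ n - b ^ n‖ ≤ n * ‖a - b‖ := by
  induction n with
  | zero => simp
  | succ n ih =>
    have : a ^ (n + 1) - b ^ (n + 1) = a * (a ^ n - b ^ n) + (a - b) * b ^ n := by ring
    rw [this]
    refine (norm_add_le _ _).trans ?_
    rw [norm_mul, norm_mul, norm_pow]
    have h1 : ‖a‖ * ‖a ^ n - b ^ n‖ ≤ 1 * (n * ‖a - b‖) :=
      mul_le_mul ha ih (norm_nonneg _) zero_le_one
    have h2 : ‖a - b‖ * ‖b‖ ^ n ≤ ‖a - b‖ * 1 :=
      mul_le_mul_of_nonneg_left (pow_le_one₀ (norm_nonneg _) hb) (norm_nonneg _)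
    push_cast
    linarith

section IID

variable {Ω : Type*} [MeasurableSpace Ω] {P : Measure Ω} [IsProbabilityMeasure P] {X : ℕ → Ω → ℝ}
  {k : ℕ} {u : ℕ → Fin k → ℝ} {τ : Fin k → ℝ}

/-- Pointwise on the torus, `n (E[g] - 1) → c` gives `E[g] ^ n → exp c`, and all powers are bounded
by `1`. -/
lemma exists_tendsto_measureReal_countEvent (hX : ∀ j, Measurable (X j))
    (hindep : iIndepFun X P) (hident : ∀ j, IdentDistrib (X j) (X 0) P P)
    (hmono : ∀ l m, (∀ᶠ n in atTop, u n l ≤ u n m) ∨ (∀ᶠ n in atTop, u n m ≤ u n l))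
    (hτ : ∀ l, Tendsto (fun n : ℕ ↦ n * (P.map (X 0)).real (Set.Ioi (u n l))) atTop (𝓝 (τ l))) :
    ∃ L, Tendsto (fun n ↦ P.real (countEvent X n (u n))) atTop (𝓝 L) := by
  have := Measure.isProbabilityMeasure_map (hX 0).aemeasurable (μ := P)
  have h (s : Fin k → UnitAddCircle) := exists_tendsto_mul_integral_levelWeight_sub_one hmono hτ
    (fun l ↦ fourier 1 (s l))
  choose c hc using h
  have key : Tendsto (fun n ↦ (P.real (countEvent X n (u n)) : ℂ)) atTop
      (𝓝 (∫ s, torusKernel k s * Complex.exp (c s) ∂torusMeasure k)) := by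
    simp_rw [measureReal_countEvent hX hindep hident]
    refine tendsto_integral_torusKernel_mul (C := 1) (fun n ↦ ?_) (fun n s ↦ ?_) fun s ↦ ?_
    · refine Measurable.pow_const ?_ n
      simpa using measurable_integral_levelWeight (u n) (e := fun _ ↦ 1) measurable_const
        (P.map (X 0))
    · rw [norm_pow]
      refine pow_le_one₀ (norm_nonneg _) ?_
      exact norm_integral_levelWeight_le (u n) (fun l ↦ norm_fourier_apply (s l))
    · refine (Complex.tendsto_one_add_pow_exp_of_tendsto (hc s)).congr fun n ↦ ?_
      rw [add_sub_cancel]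
  exact ⟨_, by simpa [Function.comp_def] using (Complex.continuous_re.tendsto _).comp key⟩

/-- The two torus integrands differ by the kernel times `A ^ n - B ^ n` with `|A|, |B| ≤ 1`, which
is at most `n |A - B|` up to the bounded kernel; here `A - B` is the one-variable covariance. -/
lemma tendsto_setIntegral_countEvent_sub (hX : ∀ j, Measurable (X j))
    (hindep : iIndepFun X P) (hident : ∀ j, IdentDistrib (X j) (X 0) P P)
    (hL2 : MemLp (X 0) 2 P)
    (hτ : ∀ l, Tendsto (fun n : ℕ ↦ n * (P.map (X 0)).real (Set.Ioi (u n l))) atTop (𝓝 (τ l)))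
    (t : ℝ) :
    Tendsto (fun n ↦ ∫ ω in countEvent X n (u n), ∏ j ∈ Finset.range n, scaledExp t n (X j ω) ∂P -
      P.real (countEvent X n (u n)) * (∫ x, scaledExp t n x ∂(P.map (X 0))) ^ n) atTop (𝓝 0) := by
  have := Measure.isProbabilityMeasure_map (hX 0).aemeasurable (μ := P)
  set μ := P.map (X 0) with hμ
  have h2 : MemLp id 2 μ :=
    (memLp_map_measure_iff aestronglyMeasurable_id (hX 0).aemeasurable).2 hL2
  have hm (n : ℕ) : Measurable fun s : Fin k → UnitAddCircle ↦
      ∫ x, levelWeight (u n) (fun l ↦ fourier 1 (s l)) x ∂μ := by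
    simpa using measurable_integral_levelWeight (u n) (e := fun _ ↦ 1) measurable_const μ
  have hn1 (n : ℕ) (s : Fin k → UnitAddCircle) :
      ‖∫ x, levelWeight (u n) (fun l ↦ fourier 1 (s l)) x ∂μ‖ ≤ 1 :=
    norm_integral_levelWeight_le (u n) (fun l ↦ norm_fourier_apply (s l))
  have hn2 (n : ℕ) (s : Fin k → UnitAddCircle) :
      ‖∫ x, levelWeight (u n) (fun l ↦ fourier 1 (s l)) x * scaledExp t n x ∂μ‖ ≤ 1 :=
    norm_integral_levelWeight_mul_le (u n) (fun l ↦ norm_fourier_apply (s l)) (norm_scaledExp t n)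
  have hn3 (n : ℕ) : ‖∫ x, scaledExp t n x ∂μ‖ ≤ 1 := by
    refine (norm_integral_le_of_norm_le_const (C := 1)
      (ae_of_all _ fun x ↦ (norm_scaledExp t n x).le)).trans (by simp)
  have hn4 (n : ℕ) (s : Fin k → UnitAddCircle) :
      ‖(∫ x, levelWeight (u n) (fun l ↦ fourier 1 (s l)) x ∂μ) * ∫ x, scaledExp t n x ∂μ‖ ≤ 1 := by
    rw [norm_mul]
    exact mul_le_one₀ (hn1 n s) (norm_nonneg _) (hn3 n)
  set F : ℕ → (Fin k → UnitAddCircle) → ℂ := fun n s ↦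
    (∫ x, levelWeight (u n) (fun l ↦ fourier 1 (s l)) x * scaledExp t n x ∂μ) ^ n -
    ((∫ x, levelWeight (u n) (fun l ↦ fourier 1 (s l)) x ∂μ) * ∫ x, scaledExp t n x ∂μ) ^ n
    with hF
  have hF2 (n : ℕ) (s) : ‖F n s‖ ≤ 2 := by
    refine (norm_sub_le _ _).trans ?_
    rw [norm_pow, norm_pow]
    linarith [pow_le_one₀ (n := n) (norm_nonneg _) (hn2 n s),
      pow_le_one₀ (n := n) (norm_nonneg _) (hn4 n s)]
  have hFm (n : ℕ) : Measurable (F n) :=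
    ((measurable_integral_levelWeight (u n) (measurable_scaledExp t n) μ).pow_const n).sub
      (((hm n).mul_const _).pow_const n)
  have hlim : Tendsto (fun n ↦ ∫ s, torusKernel k s * F n s ∂torusMeasure k) atTop
      (𝓝 (∫ s, torusKernel k s * 0 ∂torusMeasure k)) := by
    refine tendsto_integral_torusKernel_mul hFm hF2 fun s ↦ ?_
    refine squeeze_zero_norm (fun n ↦ norm_pow_sub_pow_le_mul (hn2 n s) (hn4 n s) n) ?_
    exact tendsto_mul_integral_levelWeight_mul_sub h2 hτ (fun l ↦ norm_fourier_apply (s l)) t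
  simp only [mul_zero, integral_zero] at hlim
  refine hlim.congr fun n ↦ ?_
  obtain ⟨C, hC⟩ := exists_norm_torusKernel_le k
  have hi (f : (Fin k → UnitAddCircle) → ℂ) (hf : Measurable f) (hf1 : ∀ s, ‖f s‖ ≤ 1) :
      Integrable (fun s ↦ torusKernel k s * f s ^ n) (torusMeasure k) := by
    refine Integrable.of_bound (C := C * 1)
      ((continuous_torusKernel k).measurable.mul (hf.pow_const n)).aestronglyMeasurable
      (ae_of_all _ fun s ↦ ?_)
    rw [norm_mul, norm_pow]
    exact mul_le_mul (hC s) (pow_le_one₀ (norm_nonneg _) (hf1 s)) (by positivity)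
      ((norm_nonneg _).trans (hC s))
  rw [setIntegral_countEvent hX hindep hident (measurable_scaledExp t n) (norm_scaledExp t n),
    measureReal_countEvent hX hindep hident, ← integral_mul_const, ← hμ]
  simp_rw [hF, mul_sub]
  rw [integral_sub (hi _ (measurable_integral_levelWeight (u n) (measurable_scaledExp t n) μ)
    (hn2 n)) (hi _ ((hm n).mul_const _) (hn4 n))]
  simp_rw [mul_pow, mul_assoc]

end IID

/-! ### From characteristic functions to distribution functions. -/

section IID

variable {Ω : Type*} [MeasurableSpace Ω] {P : Measure Ω} [IsProbabilityMeasure P] {X : ℕ → Ω → ℝ}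
  {k : ℕ} {u : ℕ → Fin k → ℝ} {τ : Fin k → ℝ}

lemma prod_scaledExp (x : ℕ → ℝ) (t : ℝ) (n : ℕ) : ∏ j ∈ Finset.range n, scaledExp t n (x j) =
    Complex.exp (t * ((∑ j ∈ Finset.range n, x j) / √n : ℝ) * Complex.I) := by
  simp_rw [scaledExp, ← Complex.exp_sum, ← Finset.sum_mul, ← Complex.ofReal_sum, ← Finset.mul_sum]
  congr 2
  push_cast
  ring

lemma tendsto_integral_scaledExp_pow {Y : Ω → ℝ} (hY : Measurable Y) (hmean : ∫ ω, Y ω ∂P = 0)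
    (hvar : ∫ ω, Y ω ^ 2 ∂P = 1) (t : ℝ) :
    Tendsto (fun n ↦ (∫ x, scaledExp t n x ∂(P.map Y)) ^ n) atTop
      (𝓝 (charFun (gaussianReal 0 1) t)) := by
  have h := tendsto_charFun_inv_sqrt_mul_pow hY.aemeasurable hmean hvar t
  have h1 : charFun (gaussianReal 0 1) t = Complex.exp (-t ^ 2 / 2) := by
    rw [charFun_gaussianReal]
    simp [neg_div]
  rw [h1]
  refine h.congr fun n ↦ ?_
  simp_rw [charFun_apply_real, scaledExp]
  push_cast
  rfl

lemma measurable_normalizedSum (hX : ∀ j, Measurable (X j)) (n : ℕ) :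
    Measurable fun ω ↦ (∑ j ∈ Finset.range n, X j ω) / √(n : ℝ) :=
  (Finset.measurable_fun_sum _ fun j _ ↦ hX j).div_const _

/-- The law of `f` on the event `A`, completed to a probability measure by a multiple of `γ`. -/
def completedLaw (P : Measure Ω) (A : Set Ω) (f : Ω → ℝ) (γ : Measure ℝ) : Measure ℝ :=
  (P.restrict A).map f + P Aᶜ • γ

lemma isProbabilityMeasure_completedLaw {A : Set Ω} (hA : MeasurableSet A) {f : Ω → ℝ}
    (hf : Measurable f) (γ : Measure ℝ) [IsProbabilityMeasure γ] :
    IsProbabilityMeasure (completedLaw P A f γ) := by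
  refine ⟨?_⟩
  rw [completedLaw, Measure.add_apply, Measure.map_apply hf MeasurableSet.univ]
  simp [prob_add_prob_compl hA]

lemma measureReal_completedLaw {A : Set Ω} (hA : MeasurableSet A) {f : Ω → ℝ}
    (hf : Measurable f) (γ : Measure ℝ) [IsProbabilityMeasure γ] {s : Set ℝ}
    (hs : MeasurableSet s) :
    (completedLaw P A f γ).real s = P.real (A ∩ f ⁻¹' s) + (1 - P.real A) * γ.real s := by
  rw [← probReal_compl_eq_one_sub hA, completedLaw, measureReal_def, Measure.add_apply,
    Measure.map_apply hf hs, Measure.restrict_apply (hf hs), Measure.smul_apply, smul_eq_mul,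
    ENNReal.toReal_add (measure_ne_top _ _)
      (ENNReal.mul_ne_top (measure_ne_top _ _) (measure_ne_top _ _)), ENNReal.toReal_mul,
    Set.inter_comm]
  rfl

lemma charFun_completedLaw {A : Set Ω} (hA : MeasurableSet A) {f : Ω → ℝ}
    (hf : Measurable f) (γ : Measure ℝ) [IsProbabilityMeasure γ] (t : ℝ) :
    charFun (completedLaw P A f γ) t =
      ∫ ω in A, Complex.exp (t * f ω * Complex.I) ∂P + (1 - P.real A) * charFun γ t := by
  have hint (ν : Measure ℝ) [IsFiniteMeasure ν] :
      Integrable (fun x : ℝ ↦ Complex.exp (t * x * Complex.I)) ν := by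
    refine Integrable.of_bound (C := 1) (by fun_prop) (ae_of_all _ fun x ↦ ?_)
    rw [← Complex.ofReal_mul, Complex.norm_exp_ofReal_mul_I]
  rw [charFun_apply_real, charFun_apply_real, completedLaw, integral_add_measure (hint _)
    ((hint γ).smul_measure (measure_ne_top _ _)), integral_map hf.aemeasurable (by fun_prop),
    integral_smul_measure]
  rw [← Complex.ofReal_one, ← Complex.ofReal_sub, ← probReal_compl_eq_one_sub hA,
    Complex.real_smul]
  rfl

/-- Restricting to the event loses mass, and its probability need not converge here. Filling the
missing mass with the Gaussian law gives probability measures whose characteristic functions tend to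
the Gaussian one, so the continuity theorem applies. -/
theorem tendsto_measureReal_countEvent_inter_sumEvent_sub (hX : ∀ j, Measurable (X j))
    (hindep : iIndepFun X P) (hident : ∀ j, IdentDistrib (X j) (X 0) P P)
    (hL2 : MemLp (X 0) 2 P) (hmean : ∫ ω, X 0 ω ∂P = 0) (hvar : ∫ ω, X 0 ω ^ 2 ∂P = 1)
    (hτ : ∀ l, Tendsto (fun n : ℕ ↦ n * (P.map (X 0)).real (Set.Ioi (u n l))) atTop (𝓝 (τ l)))
    (y : ℝ) :
    Tendsto (fun n ↦ P.real (countEvent X n (u n) ∩ sumEvent X n y) -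
      P.real (countEvent X n (u n)) * cdf (gaussianReal 0 1) y) atTop (𝓝 0) := by
  have hA (n : ℕ) := measurableSet_countEvent hX n (u n)
  have hS := measurable_normalizedSum hX
  set γ : Measure ℝ := gaussianReal 0 1
  let Q (n : ℕ) : ProbabilityMeasure ℝ :=
    ⟨completedLaw P (countEvent X n (u n)) (fun ω ↦ (∑ j ∈ Finset.range n, X j ω) / √(n : ℝ)) γ,
      isProbabilityMeasure_completedLaw (hA n) (hS n) γ⟩
  let γ' : ProbabilityMeasure ℝ := ⟨γ, inferInstance⟩
  have hQ : Tendsto Q atTop (𝓝 γ') := by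
    refine ProbabilityMeasure.tendsto_of_tendsto_charFun fun t ↦ ?_
    have h1 := tendsto_setIntegral_countEvent_sub hX hindep hident hL2 hτ t
    have h2 := tendsto_integral_scaledExp_pow (hX 0) hmean hvar t
    have h3 : Tendsto (fun n ↦ (P.real (countEvent X n (u n)) : ℂ) *
        ((∫ x, scaledExp t n x ∂(P.map (X 0))) ^ n - charFun γ t)) atTop (𝓝 0) := by
      refine squeeze_zero_norm (fun n ↦ ?_)
        (tendsto_zero_iff_norm_tendsto_zero.1 (tendsto_sub_nhds_zero_iff.2 h2))
      rw [norm_mul, Complex.norm_real, Real.norm_of_nonneg measureReal_nonneg]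
      exact mul_le_of_le_one_left (norm_nonneg _) measureReal_le_one
    have h4 := (h1.add h3).add_const (charFun γ t)
    rw [zero_add, zero_add] at h4
    refine h4.congr fun n ↦ ?_
    change _ = charFun (completedLaw P _ _ γ) t
    rw [charFun_completedLaw (hA n) (hS n)]
    simp_rw [prod_scaledExp]
    ring
  have hnull : (γ' : Measure ℝ) (frontier (Set.Iic y)) = 0 := by
    rw [frontier_Iic]
    have : NullSingletonClass γ := nullSingletonClass_gaussianReal one_ne_zero
    exact this.measure_singleton y
  have h := ProbabilityMeasure.tendsto_measure_of_null_frontier_of_tendsto' hQ hnull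
  have h' := (ENNReal.tendsto_toReal (measure_ne_top _ _)).comp h
  have h'' := h'.sub_const (γ.real (Set.Iic y))
  rw [cdf_eq_real]
  have e : (((γ' : Measure ℝ) (Set.Iic y)).toReal - γ.real (Set.Iic y)) = 0 := sub_self _
  rw [e] at h''
  refine h''.congr fun n ↦ ?_
  change (completedLaw P _ _ γ).real (Set.Iic y) - _ = _
  rw [measureReal_completedLaw (hA n) (hS n) γ measurableSet_Iic]
  have : (fun ω ↦ (∑ j ∈ Finset.range n, X j ω) / √(n : ℝ)) ⁻¹' Set.Iic y = sumEvent X n y := rfl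
  rw [this]
  ring

end IID

/-! ### Tail masses at the normalised levels, and bounds where `G` vanishes. -/

/-- If `(1 - p n) ^ n → g > 0` then `n * p n → -log g`. -/
lemma tendsto_mul_of_tendsto_one_sub_pow {p : ℕ → ℝ} {g : ℝ} (hg : 0 < g) (hp1 : ∀ n, p n ≤ 1)
    (h : Tendsto (fun n ↦ (1 - p n) ^ n) atTop (𝓝 g)) :
    Tendsto (fun n : ℕ ↦ n * p n) atTop (𝓝 (-Real.log g)) := by
  have hpos : ∀ᶠ n in atTop, 0 < 1 - p n := by
    filter_upwards [h.eventually_const_lt hg, eventually_gt_atTop 0] with n hn hn0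
    refine (sub_nonneg.2 (hp1 n)).lt_of_ne fun h0 ↦ ?_
    rw [← h0, zero_pow hn0.ne'] at hn
    exact lt_irrefl _ hn
  have hlog : Tendsto (fun n : ℕ ↦ n * Real.log (1 - p n)) atTop (𝓝 (Real.log g)) := by
    simpa [Real.log_pow] using h.log hg.ne'
  have hlog0 : Tendsto (fun n : ℕ ↦ Real.log (1 - p n)) atTop (𝓝 0) := by
    have := hlog.mul (tendsto_inv_atTop_nhds_zero_nat (𝕜 := ℝ))
    rw [mul_zero] at this
    refine this.congr' ?_
    filter_upwards [eventually_gt_atTop 0] with n hn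
    field_simp
  have h1 : Tendsto (fun n ↦ 1 - p n) atTop (𝓝 1) := by
    have := (Real.continuous_exp.tendsto 0).comp hlog0
    rw [Real.exp_zero] at this
    refine this.congr' ?_
    filter_upwards [hpos] with n hn using Real.exp_log hn
  -- The sandwich comes from `1 - 1 / q ≤ log q ≤ q - 1` with `q = 1 - p n`.
  have hlow : Tendsto (fun n : ℕ ↦ -(n * Real.log (1 - p n)) * (1 - p n)) atTop
      (𝓝 (-Real.log g)) := by
    simpa using hlog.neg.mul h1
  refine tendsto_of_tendsto_of_tendsto_of_le_of_le' hlow hlog.neg ?_ ?_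
  · filter_upwards [hpos] with n hn
    have h2 := Real.one_sub_inv_le_log_of_pos hn
    have h3 : -Real.log (1 - p n) * (1 - p n) ≤ p n := by
      have := mul_le_mul_of_nonneg_right h2 hn.le
      rw [sub_mul, inv_mul_cancel₀ hn.ne'] at this
      linarith
    have := mul_le_mul_of_nonneg_left h3 (Nat.cast_nonneg (α := ℝ) n)
    linarith
  · filter_upwards [hpos] with n hn
    have h2 := Real.log_le_sub_one_of_pos hn
    have := mul_le_mul_of_nonneg_left (by linarith : p n ≤ -Real.log (1 - p n))
      (Nat.cast_nonneg (α := ℝ) n)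
    linarith

/-- `(1 - p / 2) ^ 4` is at most `1 - p` for `p ≤ 1 / 2` and at most `(3 / 4) ^ 4` for `p ≥ 1 / 2`;
the nested roots undo the fourth power. -/
lemma one_sub_half_pow_le {p : ℝ} (hp0 : 0 ≤ p) (hp1 : p ≤ 1) (n : ℕ) :
    (1 - p / 2) ^ n ≤ √√((1 - p) ^ n + ((3 / 4) ^ 4) ^ n) := by
  refine Real.le_sqrt_of_sq_le (Real.le_sqrt_of_sq_le ?_)
  rw [← pow_mul, ← pow_mul, mul_comm n, pow_mul]
  have h0 : 0 ≤ (1 - p) ^ n := pow_nonneg (by linarith) n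
  have h1 : 0 ≤ (1 - p / 2) ^ (2 * 2) := pow_nonneg (by linarith) _
  rcases le_total p (1 / 2) with h | h
  · have : (1 - p / 2) ^ (2 * 2) ≤ 1 - p := by
      have e : (1 - p / 2) ^ (2 * 2) = (1 - p + p ^ 2 / 4) ^ 2 := by ring
      have h2 : p ^ 2 / 4 ≤ p / 8 := by nlinarith
      rw [e]
      nlinarith [sq_nonneg p]
    have := pow_le_pow_left₀ h1 this n
    have : (0 : ℝ) ≤ ((3 / 4) ^ 4) ^ n := by positivity
    linarith
  · have : (1 - p / 2) ^ (2 * 2) ≤ (3 / 4 : ℝ) ^ 4 :=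
      pow_le_pow_left₀ (by linarith) (by linarith) 4
    have := pow_le_pow_left₀ h1 this n
    linarith

section IID

variable {Ω : Type*} [MeasurableSpace Ω] {P : Measure Ω} [IsProbabilityMeasure P] {X : ℕ → Ω → ℝ}

lemma measureReal_exceedances_le_zero (hX : ∀ j, Measurable (X j))
    (hindep : iIndepFun X P) (hident : ∀ j, IdentDistrib (X j) (X 0) P P) (n : ℕ) (u : ℝ) :
    P.real {ω | exceedances (X · ω) n u ≤ 0} = (1 - (P.map (X 0)).real (Set.Ioi u)) ^ n := by
  have h := integral_pow_exceedances hX hindep hident n u 0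
  rw [sub_zero, one_mul] at h
  have hms : MeasurableSet {ω | exceedances (X · ω) n u ≤ 0} :=
    measurable_exceedances hX n u measurableSet_Iic
  rw [← h, ← integral_indicator_one hms]
  refine integral_congr_ae (ae_of_all _ fun ω ↦ ?_)
  by_cases h0 : exceedances (X · ω) n u = 0 <;> simp [h0]

/-- Markov's inequality for `2 ^ (-N)`, whose mean is `(1 - p / 2) ^ n`. It controls every order
statistic by the maximum alone, without a lower bound on `G`. -/
lemma measureReal_exceedances_le (hX : ∀ j, Measurable (X j))
    (hindep : iIndepFun X P) (hident : ∀ j, IdentDistrib (X j) (X 0) P P) (n m : ℕ) (u : ℝ) :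
    P.real {ω | exceedances (X · ω) n u ≤ m} ≤
      2 ^ m * √√(P.real {ω | exceedances (X · ω) n u ≤ 0} + ((3 / 4) ^ 4) ^ n) := by
  have := Measure.isProbabilityMeasure_map (hX 0).aemeasurable (μ := P)
  rw [measureReal_exceedances_le_zero hX hindep hident]
  have hint : Integrable (fun ω ↦ (1 / 2 : ℝ) ^ exceedances (X · ω) n u) P := by
    refine Integrable.of_bound (C := 1) ?_ (ae_of_all _ fun ω ↦ ?_)
    · exact ((measurable_of_countable fun N : ℕ ↦ (1 / 2 : ℝ) ^ N).comp
        (measurable_exceedances hX n u)).aestronglyMeasurable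
    · rw [norm_pow]
      exact pow_le_one₀ (norm_nonneg _) (by norm_num)
  have h := mul_meas_ge_le_integral_of_nonneg (ae_of_all _ fun ω ↦ by positivity) hint
    ((1 / 2 : ℝ) ^ m)
  rw [integral_pow_exceedances hX hindep hident] at h
  have hset : {ω | (1 / 2 : ℝ) ^ m ≤ (1 / 2 : ℝ) ^ exceedances (X · ω) n u} =
      {ω | exceedances (X · ω) n u ≤ m} := by
    ext ω
    exact pow_le_pow_iff_right_of_lt_one₀ (a := (1 / 2 : ℝ)) (by norm_num) (by norm_num)
  rw [hset] at h
  have h2 := one_sub_half_pow_le (measureReal_nonneg (μ := P.map (X 0)) (s := Set.Ioi u))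
    measureReal_le_one n
  have h3 : (2 : ℝ) ^ m * (1 / 2) ^ m = 1 := by rw [← mul_pow]; norm_num
  calc P.real {ω | exceedances (X · ω) n u ≤ m}
      = 2 ^ m * ((1 / 2) ^ m * P.real {ω | exceedances (X · ω) n u ≤ m}) := by
        rw [← mul_assoc, h3, one_mul]
    _ ≤ _ := by
        refine mul_le_mul_of_nonneg_left (h.trans (le_trans (le_of_eq ?_) h2)) (by positivity)
        ring

/-- If the event holds for `v` but fails for `u`, some variable lies in some `(u i, v i]`; then a
union bound. -/
lemma measureReal_countEvent_sub_le {k : ℕ} (hX : ∀ j, Measurable (X j))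
    (hident : ∀ j, IdentDistrib (X j) (X 0) P P) (n : ℕ) {u v : Fin k → ℝ} (huv : ∀ i, u i ≤ v i) :
    P.real (countEvent X n v) - P.real (countEvent X n u) ≤
      ∑ i, n * ((P.map (X 0)).real (Set.Ioi (u i)) - (P.map (X 0)).real (Set.Ioi (v i))) := by
  have := Measure.isProbabilityMeasure_map (hX 0).aemeasurable (μ := P)
  have hsub : countEvent X n v ⊆ countEvent X n u ∪
      ⋃ i, ⋃ j ∈ Finset.range n, X j ⁻¹' Set.Ioc (u i) (v i) := by
    intro ω hω
    by_contra hcon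
    simp only [Set.mem_union, Set.mem_iUnion, not_or, not_exists] at hcon
    refine hcon.1 fun i ↦ le_trans (Finset.card_le_card fun j hj ↦ ?_) (hω i)
    rw [Finset.mem_filter] at hj ⊢
    refine ⟨hj.1, ?_⟩
    by_contra hle
    exact hcon.2 i j hj.1 ⟨hj.2, not_lt.1 hle⟩
  have h1 (i : Fin k) (j : ℕ) : P.real (X j ⁻¹' Set.Ioc (u i) (v i)) =
      (P.map (X 0)).real (Set.Ioi (u i)) - (P.map (X 0)).real (Set.Ioi (v i)) := by
    rw [← map_measureReal_apply (hX j) measurableSet_Ioc, (hident j).map_eq,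
      ← Set.Ioi_sdiff_Ioi, measureReal_sdiff (Set.Ioi_subset_Ioi (huv i)) measurableSet_Ioi]
  have h2 : P.real (⋃ i, ⋃ j ∈ Finset.range n, X j ⁻¹' Set.Ioc (u i) (v i)) ≤
      ∑ i, n * ((P.map (X 0)).real (Set.Ioi (u i)) - (P.map (X 0)).real (Set.Ioi (v i))) := by
    refine (measureReal_iUnion_fintype_le _).trans (Finset.sum_le_sum fun i _ ↦ ?_)
    refine (measureReal_biUnion_finset_le _ _).trans_eq ?_
    simp [h1, mul_sub]
  have h3 := (measureReal_mono (μ := P) hsub).trans (measureReal_union_le _ _)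
  linarith

end IID

section IID

variable {Ω : Type*} [MeasurableSpace Ω] {P : Measure Ω} {X : ℕ → Ω → ℝ}
  {k : ℕ} {a b : ℕ → ℝ} {G : ℝ → ℝ}

lemma tendsto_two_pow_mul_sqrt_sqrt
    (hG : ∀ x, Tendsto (fun n ↦ P.real {ω | exceedances (X · ω) n (b n + x / a n) ≤ 0}) atTop
      (𝓝 (G x))) (m : ℕ) (x : ℝ) :
    Tendsto (fun n : ℕ ↦ 2 ^ m * √√(P.real {ω | exceedances (X · ω) n (b n + x / a n) ≤ 0} +
      ((3 / 4) ^ 4) ^ n)) atTop (𝓝 (2 ^ m * √√(G x))) := by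
  have h1 : Tendsto (fun n : ℕ ↦ (((3 / 4) ^ 4) ^ n : ℝ)) atTop (𝓝 0) :=
    tendsto_pow_atTop_nhds_zero_of_lt_one (by positivity) (by norm_num)
  have h2 := (hG x).add h1
  rw [add_zero] at h2
  exact h2.sqrt.sqrt.const_mul _

variable [IsProbabilityMeasure P]

lemma tendsto_mul_measureReal_Ioi (hX : ∀ j, Measurable (X j))
    (hindep : iIndepFun X P) (hident : ∀ j, IdentDistrib (X j) (X 0) P P)
    (hG : ∀ x, Tendsto (fun n ↦ P.real {ω | exceedances (X · ω) n (b n + x / a n) ≤ 0}) atTop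
      (𝓝 (G x))) {x : ℝ} (hx : 0 < G x) :
    Tendsto (fun n : ℕ ↦ n * (P.map (X 0)).real (Set.Ioi (b n + x / a n))) atTop
      (𝓝 (-Real.log (G x))) := by
  have := Measure.isProbabilityMeasure_map (hX 0).aemeasurable (μ := P)
  refine tendsto_mul_of_tendsto_one_sub_pow hx (fun n ↦ measureReal_le_one) ?_
  simpa only [measureReal_exceedances_le_zero hX hindep hident] using hG x

lemma tendsto_measureReal_countEvent_zero (hX : ∀ j, Measurable (X j))
    (hindep : iIndepFun X P) (hident : ∀ j, IdentDistrib (X j) (X 0) P P)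
    (hG : ∀ x, Tendsto (fun n ↦ P.real {ω | exceedances (X · ω) n (b n + x / a n) ≤ 0}) atTop
      (𝓝 (G x))) {x : Fin k → ℝ} {i : Fin k} (hx : G (x i) = 0) :
    Tendsto (fun n ↦ P.real (countEvent X n fun l ↦ b n + x l / a n)) atTop (𝓝 0) := by
  have h := tendsto_two_pow_mul_sqrt_sqrt hG i (x i)
  simp only [hx, Real.sqrt_zero, mul_zero] at h
  refine squeeze_zero (fun n ↦ measureReal_nonneg) (fun n ↦ ?_) h
  exact (measureReal_mono (countEvent_subset X n _ i)).trans
    (measureReal_exceedances_le hX hindep hident _ _ _)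

lemma exists_tendsto_measureReal_countEvent_level (hX : ∀ j, Measurable (X j))
    (hindep : iIndepFun X P) (hident : ∀ j, IdentDistrib (X j) (X 0) P P)
    (ha : ∀ n, 1 ≤ n → 0 < a n) (hG0 : ∀ x, 0 ≤ G x)
    (hG : ∀ x, Tendsto (fun n ↦ P.real {ω | exceedances (X · ω) n (b n + x / a n) ≤ 0}) atTop
      (𝓝 (G x))) (x : Fin k → ℝ) :
    ∃ L, Tendsto (fun n ↦ P.real (countEvent X n fun l ↦ b n + x l / a n)) atTop (𝓝 L) := by
  by_cases h : ∃ i, G (x i) = 0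
  · obtain ⟨i, hi⟩ := h
    exact ⟨0, tendsto_measureReal_countEvent_zero hX hindep hident hG hi⟩
  · push Not at h
    refine exists_tendsto_measureReal_countEvent hX hindep hident (fun l m ↦ ?_) fun l ↦
      tendsto_mul_measureReal_Ioi hX hindep hident hG ((hG0 _).lt_of_ne' (h l))
    refine (le_total (x l) (x m)).imp (fun h ↦ ?_) fun h ↦ ?_ <;>
    · filter_upwards [eventually_ge_atTop 1] with n hn
      have := ha n hn
      gcongr

lemma tendsto_measureReal_countEvent_level_inter_sub (hX : ∀ j, Measurable (X j))
    (hindep : iIndepFun X P) (hident : ∀ j, IdentDistrib (X j) (X 0) P P)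
    (hL2 : MemLp (X 0) 2 P) (hmean : ∫ ω, X 0 ω ∂P = 0) (hvar : ∫ ω, X 0 ω ^ 2 ∂P = 1)
    (hG0 : ∀ x, 0 ≤ G x)
    (hG : ∀ x, Tendsto (fun n ↦ P.real {ω | exceedances (X · ω) n (b n + x / a n) ≤ 0}) atTop
      (𝓝 (G x))) (x : Fin k → ℝ) (y : ℝ) :
    Tendsto (fun n ↦ P.real ((countEvent X n fun l ↦ b n + x l / a n) ∩ sumEvent X n y) -
      P.real (countEvent X n fun l ↦ b n + x l / a n) * cdf (gaussianReal 0 1) y) atTop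
      (𝓝 0) := by
  by_cases h : ∃ i, G (x i) = 0
  · obtain ⟨i, hi⟩ := h
    have h0 := tendsto_measureReal_countEvent_zero hX hindep hident hG hi
    have h1 : Tendsto (fun n ↦ P.real ((countEvent X n fun l ↦ b n + x l / a n) ∩ sumEvent X n y))
        atTop (𝓝 0) :=
      squeeze_zero (fun n ↦ measureReal_nonneg)
        (fun n ↦ measureReal_mono Set.inter_subset_left) h0
    simpa using h1.sub (h0.mul_const (cdf (gaussianReal 0 1) y))
  · push Not at h
    exact tendsto_measureReal_countEvent_inter_sumEvent_sub hX hindep hident hL2 hmean hvar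
      (fun l ↦ tendsto_mul_measureReal_Ioi hX hindep hident hG ((hG0 _).lt_of_ne' (h l))) y

/-- The limit of the probabilities of `countEvent` is continuous from the right. -/
lemma tendsto_limit_add_nhdsGT (hX : ∀ j, Measurable (X j))
    (hindep : iIndepFun X P) (hident : ∀ j, IdentDistrib (X j) (X 0) P P)
    (ha : ∀ n, 1 ≤ n → 0 < a n) (hG0 : ∀ x, 0 ≤ G x)
    (hGr : ∀ x, ContinuousWithinAt G (Set.Ioi x) x)
    (hG : ∀ x, Tendsto (fun n ↦ P.real {ω | exceedances (X · ω) n (b n + x / a n) ≤ 0}) atTop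
      (𝓝 (G x))) {L : (Fin k → ℝ) → ℝ}
    (hL : ∀ x, Tendsto (fun n ↦ P.real (countEvent X n fun l ↦ b n + x l / a n)) atTop
      (𝓝 (L x))) (x : Fin k → ℝ) :
    ∃ R : ℝ → ℝ, Tendsto R (𝓝[>] 0) (𝓝 (L x)) ∧
      ∀ᶠ ε in 𝓝[>] (0 : ℝ), L (fun i ↦ x i + ε) ≤ R ε := by
  have hshift (i : Fin k) : Tendsto (fun ε : ℝ ↦ G (x i + ε)) (𝓝[>] 0) (𝓝 (G (x i))) := by
    refine (hGr (x i)).tendsto.comp (tendsto_nhdsWithin_iff.2 ⟨?_, ?_⟩)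
    · have : Tendsto (fun ε : ℝ ↦ x i + ε) (𝓝 0) (𝓝 (x i + 0)) :=
        (continuous_const.add continuous_id).tendsto 0
      rw [add_zero] at this
      exact this.mono_left nhdsWithin_le_nhds
    · filter_upwards [self_mem_nhdsWithin] with ε hε
      simpa using hε
  by_cases h : ∃ i, G (x i) = 0
  · obtain ⟨i, hi⟩ := h
    have hLx : L x = 0 :=
      tendsto_nhds_unique (hL x) (tendsto_measureReal_countEvent_zero hX hindep hident hG hi)
    refine ⟨fun ε ↦ 2 ^ (i : ℕ) * √√(G (x i + ε)), ?_, Eventually.of_forall fun ε ↦ ?_⟩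
    · have := (hshift i).sqrt.sqrt.const_mul (2 ^ (i : ℕ))
      simpa [hi, hLx] using this
    · refine le_of_tendsto_of_tendsto' (hL _)
        (tendsto_two_pow_mul_sqrt_sqrt hG i (x i + ε)) fun n ↦ ?_
      exact (measureReal_mono (countEvent_subset X n _ i)).trans
        (measureReal_exceedances_le hX hindep hident _ _ _)
  · push Not at h
    have hpos (i : Fin k) : 0 < G (x i) := (hG0 _).lt_of_ne' (h i)
    -- The limit of the union bound, since the scaled tail masses converge to `-log G`.
    refine ⟨fun ε ↦ L x + ∑ i, (-Real.log (G (x i)) - -Real.log (G (x i + ε))), ?_, ?_⟩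
    · have h1 : Tendsto (fun ε ↦ ∑ i, (-Real.log (G (x i)) - -Real.log (G (x i + ε)))) (𝓝[>] 0)
          (𝓝 (∑ i, (-Real.log (G (x i)) - -Real.log (G (x i))))) :=
        tendsto_finsetSum _ fun i _ ↦ ((hshift i).log (h i)).neg.const_sub _
      simpa using h1.const_add (L x)
    · have hev : ∀ᶠ ε in 𝓝[>] (0 : ℝ), ∀ i, 0 < G (x i + ε) :=
        eventually_all.2 fun i ↦ (hshift i).eventually_const_lt (hpos i)
      filter_upwards [hev, self_mem_nhdsWithin] with ε hε hε0
      rw [← sub_le_iff_le_add']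
      refine le_of_tendsto_of_tendsto ((hL _).sub (hL x))
        (tendsto_finsetSum Finset.univ fun i _ ↦
          (tendsto_mul_measureReal_Ioi hX hindep hident hG (hpos i)).sub
          (tendsto_mul_measureReal_Ioi hX hindep hident hG (hε i))) ?_
      filter_upwards [eventually_ge_atTop 1] with n hn
      refine (measureReal_countEvent_sub_le hX hident n fun i ↦ ?_).trans_eq ?_
      · have := ha n hn
        have : 0 < ε := hε0
        gcongr
        linarith
      · simp only [mul_sub]

end IID

/-! ### Construction of the limit law. -/

/-- A tight sequence of laws on `ℝ^k` whose distribution functions converge everywhere, with a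
limit that is continuous from the right, has a limit law with that distribution function. -/
lemma exists_measure_of_tendsto_measureReal_Iic {k : ℕ} (ν : ℕ → ProbabilityMeasure (Fin k → ℝ))
    (hν : IsTightMeasureSet (Set.range fun n ↦ (ν n : Measure (Fin k → ℝ))))
    {L : (Fin k → ℝ) → ℝ}
    (hL : ∀ x, Tendsto (fun n ↦ (ν n : Measure (Fin k → ℝ)).real {z | ∀ i, z i ≤ x i}) atTop
      (𝓝 (L x)))
    (hright : ∀ x, ∃ R : ℝ → ℝ, Tendsto R (𝓝[>] 0) (𝓝 (L x)) ∧
      ∀ᶠ ε in 𝓝[>] (0 : ℝ), L (fun i ↦ x i + ε) ≤ R ε) :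
    ∃ H : Measure (Fin k → ℝ), IsProbabilityMeasure H ∧
      ∀ x : Fin k → ℝ, H.real {z | ∀ i, z i ≤ x i} = L x := by
  have hcomp : IsCompact (closure (Set.range ν)) := by
    refine isCompact_closure_of_isTightMeasureSet ?_
    convert! hν using 1
    ext μ
    simp
  -- Prokhorov's theorem gives a cluster point; an ultrafilter converging to it suffices, as the
  -- limits of the distribution functions are already known.
  obtain ⟨H, -, hH⟩ := hcomp.exists_mapClusterPt_of_frequently (l := atTop) (f := ν)
    (Frequently.of_forall fun n ↦ subset_closure (Set.mem_range_self n))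
  obtain ⟨l, hl, hlim⟩ := mapClusterPt_iff_ultrafilter.1 hH
  refine ⟨H, inferInstance, fun x ↦ ?_⟩
  have hL' (x : Fin k → ℝ) : Tendsto (fun n ↦ (ν n : Measure (Fin k → ℝ)) {z | ∀ i, z i ≤ x i}) l
      (𝓝 (ENNReal.ofReal (L x))) := by
    refine (ENNReal.tendsto_ofReal ((hL x).mono_left hl)).congr fun n ↦ ?_
    rw [measureReal_def, ENNReal.ofReal_toReal (measure_ne_top _ _)]
  have hclosed (x : Fin k → ℝ) : IsClosed {z : Fin k → ℝ | ∀ i, z i ≤ x i} :=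
    isClosed_Iic (a := x)
  have hL0 (x : Fin k → ℝ) : 0 ≤ L x := ge_of_tendsto' (hL x) fun n ↦ measureReal_nonneg
  refine le_antisymm ?_ ?_
  -- Upper bound: enlarge the closed orthant to an open one by `ε`, use the portmanteau inequality
  -- for open sets, and let `ε → 0`. The lower bound uses the inequality for closed sets.
  · obtain ⟨R, hR, hle⟩ := hright x
    refine ge_of_tendsto hR ?_
    filter_upwards [hle, self_mem_nhdsWithin] with ε hε hε0
    refine le_trans ?_ hε
    have hopen : IsOpen {z : Fin k → ℝ | ∀ i, z i < x i + ε} := by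
      simp only [Set.ofPred_forall]
      exact isOpen_iInter_of_finite fun i ↦ isOpen_lt (continuous_apply i) continuous_const
    have h1 := ProbabilityMeasure.le_liminf_measure_open_of_tendsto hlim hopen
    have h2 : (l : Filter ℕ).liminf (fun n ↦ (ν n : Measure (Fin k → ℝ)) {z | ∀ i, z i < x i + ε}) ≤
        ENNReal.ofReal (L fun i ↦ x i + ε) := by
      rw [← (hL' fun i ↦ x i + ε).liminf_eq]
      exact liminf_le_liminf (Eventually.of_forall fun n ↦
        measure_mono fun z hz i ↦ (hz i).le)
    have h3 : (H : Measure (Fin k → ℝ)) {z | ∀ i, z i ≤ x i} ≤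
        (H : Measure (Fin k → ℝ)) {z | ∀ i, z i < x i + ε} :=
      measure_mono fun z hz i ↦ (hz i).trans_lt (lt_add_of_pos_right _ hε0)
    exact ENNReal.toReal_le_of_le_ofReal (hL0 _) (h3.trans (h1.trans h2))
  · have h1 := ProbabilityMeasure.limsup_measure_closed_le_of_tendsto hlim (hclosed x)
    rw [(hL' x).limsup_eq] at h1
    exact (ENNReal.ofReal_le_iff_le_toReal (measure_ne_top _ _)).1 h1

/-! ### Right-continuity and limits at infinity of the extreme value distributions. -/

section ExtremeValue

variable {G : ℝ → ℝ}

lemma IsExtremeValueCDF.continuousWithinAt_Ioi (hG : IsExtremeValueCDF G) (x : ℝ) :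
    ContinuousWithinAt G (Set.Ioi x) x := by
  rcases hG with rfl | ⟨α, hα, rfl⟩ | ⟨α, hα, rfl⟩
  · refine Continuous.continuousWithinAt ?_
    unfold gumbelCDF
    fun_prop
  · rcases lt_trichotomy x 0 with hx | rfl | hx
    · refine ContinuousAt.continuousWithinAt ?_
      refine (continuousAt_const (y := (0 : ℝ))).congr ?_
      filter_upwards [Iio_mem_nhds hx] with z hz
      exact (if_pos (le_of_lt hz)).symm
    · have h0 : frechetCDF α 0 = 0 := if_pos le_rfl
      rw [ContinuousWithinAt, h0]
      have h1 : Tendsto (fun z : ℝ ↦ Real.exp (-z ^ (-α))) (𝓝[>] 0) (𝓝 0) :=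
        Real.tendsto_exp_neg_atTop_nhds_zero.comp (tendsto_rpow_neg_nhdsGT_zero (by linarith))
      refine h1.congr' ?_
      filter_upwards [self_mem_nhdsWithin] with z hz
      exact (if_neg (not_le.2 hz)).symm
    · refine ContinuousAt.continuousWithinAt ?_
      have h1 : ContinuousAt (fun z : ℝ ↦ Real.exp (-z ^ (-α))) x :=
        (Real.continuousAt_rpow_const _ _ (Or.inl hx.ne')).neg.rexp
      refine h1.congr ?_
      filter_upwards [Ioi_mem_nhds hx] with z hz
      exact (if_neg (not_le.2 hz)).symm
  · rcases lt_or_ge x 0 with hx | hx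
    · refine ContinuousAt.continuousWithinAt ?_
      have h1 : ContinuousAt (fun z : ℝ ↦ Real.exp (-(-z) ^ α)) x :=
        ((Real.continuousAt_rpow_const _ _ (Or.inr hα.le)).comp continuousAt_neg).neg.rexp
      refine h1.congr ?_
      filter_upwards [Iio_mem_nhds hx] with z hz
      exact (if_pos (le_of_lt hz)).symm
    · have h1 (z : ℝ) (hz : 0 ≤ z) : weibullCDF α z = 1 := by
        rcases hz.eq_or_lt with rfl | hz
        · simp [weibullCDF, Real.zero_rpow hα.ne']
        · exact if_neg (not_le.2 hz)
      exact continuousWithinAt_const.congr (fun z hz ↦ h1 z (hx.trans (le_of_lt hz))) (h1 x hx)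

lemma IsExtremeValueCDF.tendsto_atTop (hG : IsExtremeValueCDF G) : Tendsto G atTop (𝓝 1) := by
  rcases hG with rfl | ⟨α, hα, rfl⟩ | ⟨α, hα, rfl⟩
  · have h := (Real.continuous_exp.tendsto _).comp
      (Real.tendsto_exp_neg_atTop_nhds_zero.neg)
    rw [neg_zero, Real.exp_zero] at h
    exact h
  · have h := (Real.continuous_exp.tendsto _).comp
      (tendsto_rpow_neg_atTop (by linarith : 0 < α)).neg
    rw [neg_zero, Real.exp_zero] at h
    refine h.congr' ?_
    filter_upwards [eventually_gt_atTop 0] with z hz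
    exact (if_neg (not_le.2 hz)).symm
  · refine tendsto_const_nhds.congr' ?_
    filter_upwards [eventually_gt_atTop 0] with z hz
    exact (if_neg (not_le.2 hz)).symm

lemma IsExtremeValueCDF.tendsto_atBot (hG : IsExtremeValueCDF G) : Tendsto G atBot (𝓝 0) := by
  rcases hG with rfl | ⟨α, hα, rfl⟩ | ⟨α, hα, rfl⟩
  · exact Real.tendsto_exp_neg_atTop_nhds_zero.comp
      (Real.tendsto_exp_atTop.comp tendsto_neg_atBot_atTop)
  · refine tendsto_const_nhds.congr' ?_
    filter_upwards [eventually_le_atBot 0] with z hz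
    exact (if_pos hz).symm
  · refine (Real.tendsto_exp_neg_atTop_nhds_zero.comp
      ((tendsto_rpow_atTop hα).comp tendsto_neg_atBot_atTop)).congr' ?_
    filter_upwards [eventually_le_atBot 0] with z hz
    exact (if_pos hz).symm

end ExtremeValue

/-! ### Tightness of the normalised order statistics and conclusion. -/

/-- The vector of the `k` largest normalised order statistics. -/
def normalizedTop {Ω : Type*} (X : ℕ → Ω → ℝ) (a b : ℕ → ℝ) (n k : ℕ) (ω : Ω) (i : Fin k) : ℝ :=
  a n * (kthMax (X · ω) n (i + 1) - b n)

lemma normalizedTop_le_iff {Ω : Type*} (X : ℕ → Ω → ℝ) (a b : ℕ → ℝ) {n k : ℕ} (hkn : k ≤ n)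
    (ha : 0 < a n) (ω : Ω) (i : Fin k) (y : ℝ) :
    normalizedTop X a b n k ω i ≤ y ↔ exceedances (X · ω) n (b n + y / a n) ≤ i := by
  rw [← kthMax_le_iff _ (i.2.trans_le hkn), ← sub_le_iff_le_add', le_div_iff₀' ha]
  rfl

section IID

variable {Ω : Type*} [MeasurableSpace Ω] {P : Measure Ω} [IsProbabilityMeasure P] {X : ℕ → Ω → ℝ}
  {k : ℕ} {a b : ℕ → ℝ} {G : ℝ → ℝ}

lemma measurable_normalizedTop (hX : ∀ j, Measurable (X j)) {n : ℕ} (hkn : k ≤ n)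
    (ha : 0 < a n) : Measurable (normalizedTop X a b n k) := by
  refine measurable_pi_iff.2 fun i ↦ measurable_of_Iic fun y ↦ ?_
  have : (fun ω ↦ normalizedTop X a b n k ω i) ⁻¹' Set.Iic y =
      (fun ω ↦ exceedances (X · ω) n (b n + y / a n)) ⁻¹' Set.Iic (i : ℕ) := by
    ext ω
    exact normalizedTop_le_iff X a b hkn ha ω i y
  rw [this]
  exact measurable_exceedances hX n _ measurableSet_Iic

/-- If the norm exceeds `r`, either some variable exceeds the level of `r`, or some coordinate is
below `-r`. -/
lemma measureReal_lt_norm_normalizedTop_le (hX : ∀ j, Measurable (X j))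
    (hindep : iIndepFun X P) (hident : ∀ j, IdentDistrib (X j) (X 0) P P)
    {n : ℕ} (hkn : k ≤ n) (ha : 0 < a n) {r : ℝ} (hr : 0 ≤ r) :
    P.real {ω | r < ‖normalizedTop X a b n k ω‖} ≤
      (1 - P.real {ω | exceedances (X · ω) n (b n + r / a n) ≤ 0}) + ∑ i : Fin k, 2 ^ (i : ℕ) *
        √√(P.real {ω | exceedances (X · ω) n (b n + -r / a n) ≤ 0} + ((3 / 4) ^ 4) ^ n) := by
  have hsub : {ω | r < ‖normalizedTop X a b n k ω‖} ⊆
      {ω | exceedances (X · ω) n (b n + r / a n) ≤ 0}ᶜ ∪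
        ⋃ i : Fin k, {ω | exceedances (X · ω) n (b n + -r / a n) ≤ i} := by
    intro ω hω
    by_contra hcon
    simp only [Set.mem_union, Set.mem_compl_iff, Set.mem_iUnion, not_or, not_exists,
      not_not] at hcon
    refine hω.not_ge ((pi_norm_le_iff_of_nonneg hr).2 fun i ↦ abs_le.2 ⟨?_, ?_⟩)
    · by_contra hlt
      exact hcon.2 i ((normalizedTop_le_iff X a b hkn ha ω i (-r)).1 (not_le.1 hlt).le)
    · exact (normalizedTop_le_iff X a b hkn ha ω i r).2 (le_trans hcon.1 (Nat.zero_le _))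
  have hms : MeasurableSet {ω | exceedances (X · ω) n (b n + r / a n) ≤ 0} :=
    measurable_exceedances hX n _ measurableSet_Iic
  refine (measureReal_mono (μ := P) hsub).trans ((measureReal_union_le _ _).trans ?_)
  rw [probReal_compl_eq_one_sub hms]
  refine add_le_add_right ((measureReal_iUnion_fintype_le _).trans
    (Finset.sum_le_sum fun i _ ↦ ?_)) _
  exact measureReal_exceedances_le hX hindep hident _ _ _

/-- The shift to `n + k` ensures that all `k` order statistics exist and that the scale is positive.
-/
lemma isTightMeasureSet_range_map_normalizedTop (hX : ∀ j, Measurable (X j))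
    (hindep : iIndepFun X P) (hident : ∀ j, IdentDistrib (X j) (X 0) P P)
    (ha : ∀ n, 1 ≤ n → 0 < a n) (hk : 1 ≤ k)
    (hG : ∀ x, Tendsto (fun n ↦ P.real {ω | exceedances (X · ω) n (b n + x / a n) ≤ 0}) atTop
      (𝓝 (G x))) (htop : Tendsto G atTop (𝓝 1)) (hbot : Tendsto G atBot (𝓝 0)) :
    IsTightMeasureSet (Set.range fun n ↦ P.map (normalizedTop X a b (n + k) k)) := by
  have han (n : ℕ) : 0 < a (n + k) := ha _ (by omega)
  have hVm (n : ℕ) : Measurable (normalizedTop X a b (n + k) k) :=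
    measurable_normalizedTop hX (by omega) (han n)
  have hlim : Tendsto (fun r : ℝ ↦ ENNReal.ofReal ((1 - G r) +
      ∑ i : Fin k, 2 ^ (i : ℕ) * √√(G (-r)))) atTop (𝓝 0) := by
    have h1 := hbot.comp tendsto_neg_atTop_atBot
    have h2 := (htop.const_sub 1).add (tendsto_finsetSum Finset.univ
      fun (i : Fin k) _ ↦ h1.sqrt.sqrt.const_mul (2 ^ (i : ℕ)))
    have h3 := ENNReal.tendsto_ofReal h2
    simpa using h3
  refine isTightMeasureSet_range_of_tendsto_limsup_measure_norm_gt ?_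
  refine tendsto_of_tendsto_of_tendsto_of_le_of_le' tendsto_const_nhds hlim
    (Eventually.of_forall fun _ ↦ zero_le) ?_
  filter_upwards [eventually_ge_atTop 0] with r hr
  have hr' := ENNReal.tendsto_ofReal (((hG r).const_sub 1).add (tendsto_finsetSum Finset.univ
    fun (i : Fin k) _ ↦ tendsto_two_pow_mul_sqrt_sqrt hG i (-r)))
  rw [← (hr'.comp (tendsto_add_atTop_nat k)).limsup_eq]
  refine limsup_le_limsup (Eventually.of_forall fun n ↦ ?_)
  simp only [Function.comp_apply]
  rw [Measure.map_apply (hVm n) (measurableSet_lt measurable_const measurable_norm)]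
  refine (ENNReal.le_ofReal_iff_toReal_le (measure_ne_top _ _) ?_).2
    (measureReal_lt_norm_normalizedTop_le hX hindep hident (by omega) (han n) hr)
  exact add_nonneg (sub_nonneg.2 measureReal_le_one)
    (Finset.sum_nonneg fun i _ ↦ by positivity)

theorem exists_limit_law_topEvent (hX : ∀ j, Measurable (X j))
    (hindep : iIndepFun X P) (hident : ∀ j, IdentDistrib (X j) (X 0) P P)
    (hL2 : MemLp (X 0) 2 P) (hmean : ∫ ω, X 0 ω ∂P = 0) (hvar : ∫ ω, X 0 ω ^ 2 ∂P = 1)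
    (ha : ∀ n, 1 ≤ n → 0 < a n) (hG : IsExtremeValueCDF G)
    (hmax : ∀ x : ℝ, Tendsto
      (fun n : ℕ => P.real {ω | a n * (kthMax (fun j => X j ω) n 1 - b n) ≤ x}) atTop (𝓝 (G x)))
    (hk : 1 ≤ k) :
    ∃ H : Measure (Fin k → ℝ), IsProbabilityMeasure H ∧
      (∀ x : Fin k → ℝ, Tendsto (fun n : ℕ => P.real (topEvent X a b n k x)) atTop
        (𝓝 (H.real {z | ∀ i, z i ≤ x i}))) ∧
      ∀ (x : Fin k → ℝ) (y : ℝ), Tendsto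
        (fun n : ℕ => P.real (topEvent X a b n k x ∩ sumEvent X n y)
          - P.real (topEvent X a b n k x) * cdf (gaussianReal 0 1) y) atTop (𝓝 0) := by
  have hG0 (x : ℝ) : 0 ≤ G x := ge_of_tendsto' (hmax x) fun n ↦ measureReal_nonneg
  have hN (x : ℝ) : Tendsto (fun n ↦ P.real {ω | exceedances (X · ω) n (b n + x / a n) ≤ 0}) atTop
      (𝓝 (G x)) := by
    refine (hmax x).congr' ?_
    filter_upwards [eventually_ge_atTop 1] with n hn
    congr 1
    ext ω
    exact normalizedTop_le_iff X a b hn (ha n hn) ω (0 : Fin 1) x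
  have hev (x : Fin k → ℝ) : ∀ᶠ n in atTop,
      (countEvent X n fun l ↦ b n + x l / a n) = topEvent X a b n k x := by
    filter_upwards [eventually_ge_atTop k] with n hn
    exact (topEvent_eq_countEvent X a b hn (ha n (hk.trans hn)) x).symm
  choose L hL using exists_tendsto_measureReal_countEvent_level (k := k) hX hindep hident ha hG0 hN
  have hL' (x : Fin k → ℝ) : Tendsto (fun n : ℕ => P.real (topEvent X a b n k x)) atTop
      (𝓝 (L x)) := by
    refine (hL x).congr' ?_
    filter_upwards [hev x] with n hn
    rw [hn]
  have han (n : ℕ) : 0 < a (n + k) := ha _ (by omega)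
  have hVm (n : ℕ) : Measurable (normalizedTop X a b (n + k) k) :=
    measurable_normalizedTop hX (by omega) (han n)
  obtain ⟨H, hH, hHL⟩ := exists_measure_of_tendsto_measureReal_Iic
    (fun n ↦ ⟨P.map (normalizedTop X a b (n + k) k),
      Measure.isProbabilityMeasure_map (hVm n).aemeasurable⟩)
    (isTightMeasureSet_range_map_normalizedTop hX hindep hident ha hk hN hG.tendsto_atTop
      hG.tendsto_atBot) (L := L)
    (fun x ↦ by
      refine ((hL' x).comp (tendsto_add_atTop_nat k)).congr fun n ↦ ?_
      exact (map_measureReal_apply (hVm n) (measurableSet_Iic (a := x))).symm)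
    (tendsto_limit_add_nhdsGT hX hindep hident ha hG0 hG.continuousWithinAt_Ioi hN hL)
  refine ⟨H, hH, fun x ↦ by rw [hHL]; exact hL' x, fun x y ↦ ?_⟩
  refine (tendsto_measureReal_countEvent_level_inter_sub hX hindep hident hL2 hmean hvar hG0 hN
    x y).congr' ?_
  filter_upwards [hev x] with n hn
  rw [hn]

/-- The standard central limit theorem for `sumEvent`. -/
lemma tendsto_measureReal_sumEvent (hX : ∀ j, Measurable (X j))
    (hindep : iIndepFun X P) (hident : ∀ j, IdentDistrib (X j) (X 0) P P)
    (hL2 : MemLp (X 0) 2 P) (hmean : ∫ ω, X 0 ω ∂P = 0) (hvar : ∫ ω, X 0 ω ^ 2 ∂P = 1) (y : ℝ) :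
    Tendsto (fun n ↦ P.real (sumEvent X n y)) atTop (𝓝 (cdf (gaussianReal 0 1) y)) := by
  -- With no levels the count event is the whole space.
  have h := tendsto_measureReal_countEvent_inter_sumEvent_sub (k := 0) (u := fun _ ↦ Fin.elim0)
    (τ := Fin.elim0) hX hindep hident hL2 hmean hvar (fun l ↦ l.elim0) y
  have huniv (n : ℕ) : countEvent X n (Fin.elim0 : Fin 0 → ℝ) = Set.univ :=
    Set.eq_univ_of_forall fun ω l ↦ l.elim0
  simp only [huniv, Set.univ_inter, probReal_univ, one_mul] at h
  exact tendsto_sub_nhds_zero_iff.1 h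

end IID

end

theorem theorem2p5 {Ω : Type*} [MeasurableSpace Ω] (P : Measure Ω) [IsProbabilityMeasure P]
    (X : ℕ → Ω → ℝ) (hindep : iIndepFun X P) (hident : ∀ j, IdentDistrib (X j) (X 0) P P)
    (hL2 : MemLp (X 0) 2 P) (hmean : ∫ ω, X 0 ω ∂P = 0) (hvar : ∫ ω, X 0 ω ^ 2 ∂P = 1)
    (a b : ℕ → ℝ) (ha : ∀ n, 1 ≤ n → 0 < a n)
    (G : ℝ → ℝ) (hG : IsExtremeValueCDF G)
    (hmax : ∀ x : ℝ, Tendsto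
      (fun n : ℕ => P.real {ω | a n * (kthMax (fun j => X j ω) n 1 - b n) ≤ x}) atTop (𝓝 (G x)))
    (k : ℕ) (hk : 1 ≤ k) :
    ∃ H : Measure (Fin k → ℝ), IsProbabilityMeasure H ∧
      (∀ x : Fin k → ℝ, Tendsto (fun n : ℕ => P.real (topEvent X a b n k x)) atTop
        (𝓝 (H.real {z | ∀ i, z i ≤ x i}))) ∧
      (∀ (x : Fin k → ℝ) (y : ℝ), Tendsto
        (fun n : ℕ => P.real (topEvent X a b n k x ∩ sumEvent X n y)) atTop
        (𝓝 (H.real {z | ∀ i, z i ≤ x i} * cdf (gaussianReal 0 1) y))) ∧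
      (∀ (x : Fin k → ℝ) (y : ℝ), Tendsto
        (fun n : ℕ => P.real (topEvent X a b n k x ∩ sumEvent X n y)
          - P.real (topEvent X a b n k x) * P.real (sumEvent X n y)) atTop (𝓝 0)) := by
  -- Identical distribution gives only a.e. measurability, so the variables are replaced by
  -- measurable versions; all events change by null sets.
  have haem (j : ℕ) : AEMeasurable (X j) P := (hident j).aemeasurable_fst
  set Y : ℕ → Ω → ℝ := fun j ↦ (haem j).mk (X j) with hY
  have hYm (j : ℕ) : Measurable (Y j) := (haem j).measurable_mk
  have hXY (j : ℕ) : X j =ᵐ[P] Y j := (haem j).ae_eq_mk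
  have hall : ∀ᵐ ω ∂P, (X · ω) = (Y · ω) := by
    filter_upwards [ae_all_iff.2 hXY] with ω hω using funext hω
  have hYi : iIndepFun Y P := hindep.congr hXY
  have hYd (j : ℕ) : IdentDistrib (Y j) (Y 0) P P :=
    ((IdentDistrib.of_ae_eq (haem j) (hXY j)).symm.trans (hident j)).trans
      (IdentDistrib.of_ae_eq (haem 0) (hXY 0))
  have htop (n : ℕ) (x : Fin k → ℝ) : topEvent Y a b n k x =ᵐ[P] topEvent X a b n k x := by
    filter_upwards [hall] with ω hω
    change (∀ i : Fin k, a n * (kthMax (Y · ω) n (i + 1) - b n) ≤ x i) =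
      (∀ i : Fin k, a n * (kthMax (X · ω) n (i + 1) - b n) ≤ x i)
    rw [hω]
  have hsum (n : ℕ) (y : ℝ) : sumEvent Y n y =ᵐ[P] sumEvent X n y := by
    filter_upwards [ae_all_iff.2 hXY] with ω hω
    change ((∑ j ∈ Finset.range n, Y j ω) / √(n : ℝ) ≤ y) =
      ((∑ j ∈ Finset.range n, X j ω) / √(n : ℝ) ≤ y)
    simp_rw [hω]
  have hYmax (x : ℝ) : Tendsto
      (fun n : ℕ => P.real {ω | a n * (kthMax (fun j => Y j ω) n 1 - b n) ≤ x}) atTop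
      (𝓝 (G x)) := by
    refine (hmax x).congr fun n ↦ measureReal_congr ?_
    filter_upwards [hall] with ω hω
    change (a n * (kthMax (X · ω) n 1 - b n) ≤ x) = (a n * (kthMax (Y · ω) n 1 - b n) ≤ x)
    rw [hω]
  have hY2 : MemLp (Y 0) 2 P := (memLp_congr_ae (hXY 0)).1 hL2
  have hY0 : ∫ ω, Y 0 ω ∂P = 0 := by rw [← hmean]; exact integral_congr_ae (hXY 0).symm
  have hY1 : ∫ ω, Y 0 ω ^ 2 ∂P = 1 := by
    rw [← hvar]
    refine integral_congr_ae ?_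
    filter_upwards [hXY 0] with ω hω
    rw [hω]
  obtain ⟨H, hH, hlim, hjoint⟩ :=
    exists_limit_law_topEvent hYm hYi hYd hY2 hY0 hY1 ha hG hYmax hk
  have hclt (y : ℝ) := tendsto_measureReal_sumEvent hYm hYi hYd hY2 hY0 hY1 y
  simp only [fun n x ↦ measureReal_congr (htop n x), fun n y ↦ measureReal_congr (hsum n y),
    fun n x y ↦ measureReal_congr ((htop n x).inter (hsum n y))] at hlim hjoint hclt
  have hprod (x : Fin k → ℝ) (y : ℝ) : Tendsto
      (fun n : ℕ => P.real (topEvent X a b n k x ∩ sumEvent X n y)) atTop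
      (𝓝 (H.real {z | ∀ i, z i ≤ x i} * cdf (gaussianReal 0 1) y)) := by
    simpa using (hjoint x y).add ((hlim x).mul_const (cdf (gaussianReal 0 1) y))
  refine ⟨H, hH, hlim, hprod, fun x y ↦ ?_⟩
  simpa using (hprod x y).sub ((hlim x).mul (hclt y))
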